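/- Let $\mathfrak A$, $A$, $B$ be (not necessarily unital) $C^*$-algebras. Suppose that $A$ and $B$ are $\mathfrak A$-bimodules with compatible actions: the left and right actions on $A$ are bilinear, bounded ($\|\alpha\cdot a\|,\|a\cdot\alpha\|\le k\|a\|\|\alpha\|$ for some $k>0$), and satisfy $\alpha\cdot(ab)=(\alpha\cdot a)b$, $(ab)\cdot\alpha=a(b\cdot\alpha)$, $(\alpha\cdot a)^*=a^*\cdot\alpha^*$, $(a\cdot\alpha)^*=\alpha^*\cdot a^*$ for all $\alpha\in\mathfrak A$ and $a,b\in A$, and similarly for $B$. Let $A\odot B$ be the algebraic tensor product over $\mathbb C$, let $\|\cdot\|_{\max}$ be its maximal $C^*$-norm (the supremum of $\|\varphi(x)\|$ over all $*$-homomorphisms $\varphi$ of $A\odot B$ into $C^*$-algebras), and let $I$ be the two-sided ideal of $A\odot B$ generated by the elements $a\cdot\alpha\otimes b-a\otimes\alpha\cdot b$. The module tensor product $A\otimes_{\mathfrak A,\max}B$ is the (Hausdorff) completion of $(A\odot B)/I$ in the quotient norm $\|x+I\|=\inf_{i\in I}\|x+i\|_{\max}$; equivalently, it is the $C^*$-algebra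 $(A\otimes_{\max}B)/\overline I$. Assume that both actions are right-trivial with the same character: there is a character (nonzero multiplicative linear functional) $f$ of $\mathfrak A$ such that $a\cdot\alpha=f(\alpha)a$ and $b\cdot\alpha=f(\alpha)b$ for all $\alpha\in\mathfrak A$, $a\in A$, $b\in B$. Let $N$ be a closed two-sided ideal of $A$; then $N$ is $\mathfrak A$-invariant, and $N$ and $A/N$ carry the restricted and the induced compatible action, respectively. Then the canonical maps $\iota: n\otimes b\mapsto n\otimes b$ and $q: a\otimes b\mapsto (a+N)\otimes b$ are well-defined $*$-homomorphisms forming an exact sequence $$0\to N\otimes_{\mathfrak A,\max}B\xrightarrow{\ \iota\ }A\otimes_{\mathfrak A,\max}B\xrightarrow{\ q\ }\frac AN\otimes_{\mathfrak A,\max}B\to 0 ,$$ where $\iota$ is isometric and identifies $N\otimes_{\mathfrak A,\max}B$ with a closed two-sided ideal of $A\otimes_{\mathfrak A,\max}B$, and there is an isometric $*$-isomorphism $$\frac AN\otimes_{\mathfrak A,\max}B\;\simeq\;(A\otimes_{\mathfrak A,\max}B)/(N\otimes_{\mathfrak A,\max}B),\qquad (a+N)\otimes b\mapsto [a\otimes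 b].$$ -/

import Mathlib

open scoped TensorProduct

universe u v w

/-- A closed two-sided ideal of a (not necessarily unital) C⋆-algebra. -/
structure ClosedIdeal (A : Type u) [NonUnitalCStarAlgebra A] extends Submodule ℂ A where
  mul_mem_left' : ∀ (a : A) {x : A}, x ∈ carrier → a * x ∈ carrier
  mul_mem_right' : ∀ (a : A) {x : A}, x ∈ carrier → x * a ∈ carrier
  isClosed' : IsClosed carrier

namespace ClosedIdeal

variable {A : Type u} [NonUnitalCStarAlgebra A]

instance : SetLike (ClosedIdeal A) A where
  coe N := N.carrier
  coe_injective := by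
    rintro ⟨N, _⟩ ⟨M, _⟩ h
    have : N = M := SetLike.coe_injective h
    subst this
    rfl

theorem mul_mem_left (N : ClosedIdeal A) (a : A) {x : A} (hx : x ∈ N) : a * x ∈ N :=
  N.mul_mem_left' a hx

theorem mul_mem_right (N : ClosedIdeal A) (a : A) {x : A} (hx : x ∈ N) : x * a ∈ N :=
  N.mul_mem_right' a hx

instance : NonUnitalSubringClass (ClosedIdeal A) A where
  add_mem {N} _ _ := N.toSubmodule.add_mem
  zero_mem N := N.toSubmodule.zero_mem
  neg_mem {N} _ := N.toSubmodule.neg_mem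
  mul_mem {N} a _ _ hb := N.mul_mem_left a hb

instance : SMulMemClass (ClosedIdeal A) ℂ A where
  smul_mem {N} c _ h := N.toSubmodule.smul_mem c h

instance isClosed_coe (N : ClosedIdeal A) : IsClosed (N : Set A) := N.isClosed'

instance isClosed_toSubmodule (N : ClosedIdeal A) : IsClosed (N.toSubmodule : Set A) := N.isClosed'

set_option maxHeartbeats 2000000 in
/-- Approximate right units lying in the ideal. -/
theorem exists_approx (N : ClosedIdeal A) (z : A) (hz : star z * z ∈ N) {ε : ℝ} (hε : 0 < ε) :
    ∃ e ∈ N, star e = e ∧ ‖z - z * e‖ ≤ ε ∧ ∀ x : A, ‖x - x * e‖ ≤ ‖x‖ := by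
  let _ := CStarAlgebra.spectralOrder A
  have := CStarAlgebra.spectralOrderedRing A
  let _ := CStarAlgebra.spectralOrder (Unitization ℂ A)
  have := CStarAlgebra.spectralOrderedRing (Unitization ℂ A)
  set y := star z * z with hy
  have hsa : IsSelfAdjoint y := IsSelfAdjoint.star_mul_self z
  set s : ℝ := 1 / (2 * ε ^ 2) with hs
  have hs0 : 0 < s := by positivity
  have hpos : ∀ t : ℝ, 0 < 1 + s ^ 2 * t ^ 2 := fun t => by positivity
  obtain ⟨g, hgdef⟩ : ∃ g : ℝ → ℝ, ∀ t, g t = s ^ 2 * t ^ 2 / (1 + s ^ 2 * t ^ 2) :=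
    ⟨_, fun _ => rfl⟩
  have hg : Continuous g := by
    rw [show g = _ from funext hgdef]
    exact Continuous.div (by fun_prop) (by fun_prop) fun t => (hpos t).ne'
  have hg0 : g 0 = 0 := by simp [hgdef]
  have hg1 : ∀ t, 0 ≤ g t := fun t => by rw [hgdef]; positivity
  have hg2 : ∀ t, g t ≤ 1 := fun t => by
    rw [hgdef, div_le_one (hpos t)]; linarith
  obtain ⟨e, he⟩ : ∃ e, e = cfcₙ g y := ⟨_, rfl⟩
  have hidy : cfcₙ (fun t : ℝ => t) y = y := cfcₙ_id' ℝ y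
  have hesa : IsSelfAdjoint e := he ▸ cfcₙ_predicate g y
  refine ⟨e, ?_, hesa, ?_, ?_⟩
  · have key : e = ((s ^ 2 : ℝ) : ℂ) • (y * y) - ((s ^ 2 : ℝ) : ℂ) • (y * (y * e)) := by
      have h1 : e = cfcₙ (fun t : ℝ => s ^ 2 * (t * t) - s ^ 2 * (t * (t * g t))) y := by
        rw [he]
        refine cfcₙ_congr fun t _ => ?_
        have := (hpos t).ne'
        simp only [hgdef]
        field_simp
        ring
      refine h1.trans ?_
      rw [cfcₙ_sub (fun t : ℝ => s ^ 2 * (t * t)) (fun t : ℝ => s ^ 2 * (t * (t * g t))) y,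
        cfcₙ_const_mul (s ^ 2) (fun t : ℝ => t * t) y,
        cfcₙ_const_mul (s ^ 2) (fun t : ℝ => t * (t * g t)) y,
        cfcₙ_mul (fun t : ℝ => t) (fun t : ℝ => t) y,
        cfcₙ_mul (fun t : ℝ => t) (fun t : ℝ => t * g t) y,
        cfcₙ_mul (fun t : ℝ => t) g y, hidy, ← he]
      simp only [Complex.coe_smul]
    rw [key]
    exact sub_mem (SMulMemClass.smul_mem _ (N.mul_mem_right _ hz))
      (SMulMemClass.smul_mem _ (N.mul_mem_right _ hz))
  · have key : star (z - z * e) * (z - z * e)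
        = cfcₙ (fun t : ℝ => t - t * g t - (g t * t - g t * (t * g t))) y := by
      rw [cfcₙ_sub (fun t : ℝ => t - t * g t) (fun t : ℝ => g t * t - g t * (t * g t)) y,
        cfcₙ_sub (fun t : ℝ => t) (fun t : ℝ => t * g t) y,
        cfcₙ_sub (fun t : ℝ => g t * t) (fun t : ℝ => g t * (t * g t)) y,
        cfcₙ_mul g (fun t : ℝ => t) y,
        cfcₙ_mul g (fun t : ℝ => t * g t) y,
        cfcₙ_mul (fun t : ℝ => t) g y, hidy, ← he, star_sub, star_mul, hesa.star_eq, hy]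
      simp only [sub_mul, mul_sub, mul_assoc]
      abel
    have hb : ‖star (z - z * e) * (z - z * e)‖ ≤ ε ^ 2 := by
      rw [key]
      refine norm_cfcₙ_le fun t _ => ?_
      have h0 : t - t * g t - (g t * t - g t * (t * g t)) = t * (1 - g t) * (1 - g t) := by ring
      have h1 : t * (1 - g t) = t / (1 + s ^ 2 * t ^ 2) := by
        have := (hpos t).ne'
        simp only [hgdef]
        field_simp
        ring
      have h2 : ε ^ 2 = 1 / (2 * s) := by rw [hs]; field_simp
      rw [h0, h1, norm_mul, Real.norm_eq_abs, Real.norm_eq_abs, abs_div, abs_of_pos (hpos t),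
        abs_of_nonneg (sub_nonneg.2 (hg2 t)), h2]
      have h3 : |t| / (1 + s ^ 2 * t ^ 2) ≤ 1 / (2 * s) := by
        rw [div_le_div_iff₀ (hpos t) (by positivity)]
        have := sq_nonneg (s * |t| - 1)
        have h4 : |t| ^ 2 = t ^ 2 := sq_abs t
        nlinarith
      calc _ ≤ 1 / (2 * s) * 1 :=
            mul_le_mul h3 (by linarith [hg1 t]) (sub_nonneg.2 (hg2 t)) (by positivity)
        _ = _ := mul_one _
    rw [CStarRing.norm_star_mul_self] at hb
    exact le_of_sq_le_sq (by nlinarith) hε.le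
  · intro x
    have h1 : (e : Unitization ℂ A) ∈ Set.Icc 0 1 :=
      CStarAlgebra.inr_mem_Icc_iff_norm_le.2 ⟨he ▸ cfcₙ_nonneg fun t _ => hg1 t,
        he ▸ norm_cfcₙ_le fun t _ => by
          rw [Real.norm_eq_abs, abs_of_nonneg (hg1 t)]; exact hg2 t⟩
    have h2 : ‖(1 : Unitization ℂ A) - (e : Unitization ℂ A)‖ ≤ 1 :=
      (CStarAlgebra.mem_Icc_iff_norm_le_one.1 (Set.sub_mem_Icc_zero_iff_right.2 h1)).2
    have h3 : ((x - x * e : A) : Unitization ℂ A) = (x : Unitization ℂ A) * (1 - e) := by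
      rw [mul_sub, mul_one, Unitization.inr_sub, Unitization.inr_mul]
    calc ‖x - x * e‖ = ‖((x - x * e : A) : Unitization ℂ A)‖ := (Unitization.norm_inr (𝕜 := ℂ) _).symm
      _ ≤ ‖(x : Unitization ℂ A)‖ * ‖(1 : Unitization ℂ A) - e‖ := by
          rw [h3]; exact norm_mul_le _ _
      _ ≤ ‖(x : Unitization ℂ A)‖ * 1 := by gcongr
      _ = ‖x‖ := by rw [mul_one, Unitization.norm_inr]

/-- A norm-limit criterion for membership in a closed ideal. -/
theorem mem_of_approx (N : ClosedIdeal A) {x : A}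
    (h : ∀ ε : ℝ, 0 < ε → ∃ n ∈ N, ‖x - n‖ ≤ ε) : x ∈ N := by
  have : x ∈ closure (N : Set A) := Metric.mem_closure_iff.2 fun ε hε => by
    obtain ⟨n, hn, hle⟩ := h (ε / 2) (by positivity)
    exact ⟨n, hn, by rw [dist_eq_norm]; linarith⟩
  rwa [(isClosed_coe N).closure_eq] at this

instance : StarMemClass (ClosedIdeal A) A where
  star_mem {N} x hx := N.mem_of_approx fun ε hε => by
    obtain ⟨e, he, -, hle, -⟩ := N.exists_approx (star x)
      (by rw [star_star]; exact N.mul_mem_right _ hx) hε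
    exact ⟨star x * e, N.mul_mem_left _ he, hle⟩

/-- The quotient of a C⋆-algebra by a closed two-sided ideal, with the quotient norm. -/
def Quotient (N : ClosedIdeal A) : Type u := A ⧸ N.toSubmodule

namespace Quotient

variable (N : ClosedIdeal A)

noncomputable instance : NormedAddCommGroup N.Quotient :=
  inferInstanceAs (NormedAddCommGroup (A ⧸ N.toSubmodule))

noncomputable instance : NormedSpace ℂ N.Quotient :=
  inferInstanceAs (NormedSpace ℂ (A ⧸ N.toSubmodule))

instance : CompleteSpace N.Quotient :=
  inferInstanceAs (CompleteSpace (A ⧸ N.toSubmodule))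

/-- The canonical linear surjection `A → A/N`. -/
def mkₗ : A →ₗ[ℂ] N.Quotient := N.toSubmodule.mkQ

theorem mkₗ_surjective : Function.Surjective (mkₗ N) := N.toSubmodule.mkQ_surjective

theorem mkₗ_eq_zero {x : A} : mkₗ N x = 0 ↔ x ∈ N := Submodule.Quotient.mk_eq_zero _

theorem mkₗ_eq {x y : A} : mkₗ N x = mkₗ N y ↔ x - y ∈ N := Submodule.Quotient.eq _

theorem norm_mkₗ_le (x : A) : ‖mkₗ N x‖ ≤ ‖x‖ := Submodule.Quotient.norm_mk_le _ x

theorem exists_norm_lt (x : N.Quotient) {ε : ℝ} (hε : 0 < ε) :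
    ∃ a, mkₗ N a = x ∧ ‖a‖ < ‖x‖ + ε := Submodule.Quotient.norm_mk_lt x hε

instance : Mul N.Quotient where
  mul := Quotient.map₂ (· * ·) fun a a' h b b' h' => by
    have h1 : a - a' ∈ N := (mkₗ_eq N).1 (Quotient.sound h)
    have h2 : b - b' ∈ N := (mkₗ_eq N).1 (Quotient.sound h')
    refine Quotient.exact ((mkₗ_eq N).2 ?_ : mkₗ N (a * b) = mkₗ N (a' * b'))
    have : a * b - a' * b' = (a - a') * b + a' * (b - b') := by noncomm_ring
    rw [this]
    exact add_mem (N.mul_mem_right _ h1) (N.mul_mem_left _ h2)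

instance : Star N.Quotient where
  star := Quotient.map star fun a a' h => by
    have h1 : a - a' ∈ N := (mkₗ_eq N).1 (Quotient.sound h)
    refine Quotient.exact ((mkₗ_eq N).2 ?_ : mkₗ N (star a) = mkₗ N (star a'))
    rw [← star_sub]
    exact star_mem h1

theorem mkₗ_mul (a b : A) : mkₗ N (a * b) = mkₗ N a * mkₗ N b := rfl

theorem mkₗ_star (a : A) : mkₗ N (star a) = star (mkₗ N a) := rfl

noncomputable instance : NonUnitalNormedRing N.Quotient where
  __ := (inferInstance : NormedAddCommGroup N.Quotient)
  left_distrib x y z := by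
    obtain ⟨x, rfl⟩ := mkₗ_surjective N x
    obtain ⟨y, rfl⟩ := mkₗ_surjective N y
    obtain ⟨z, rfl⟩ := mkₗ_surjective N z
    rw [← map_add, ← mkₗ_mul, mul_add, map_add]; rfl
  right_distrib x y z := by
    obtain ⟨x, rfl⟩ := mkₗ_surjective N x
    obtain ⟨y, rfl⟩ := mkₗ_surjective N y
    obtain ⟨z, rfl⟩ := mkₗ_surjective N z
    rw [← map_add, ← mkₗ_mul, add_mul, map_add]; rfl
  zero_mul x := by
    obtain ⟨x, rfl⟩ := mkₗ_surjective N x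
    rw [← map_zero (mkₗ N), ← mkₗ_mul, zero_mul]
  mul_zero x := by
    obtain ⟨x, rfl⟩ := mkₗ_surjective N x
    rw [← map_zero (mkₗ N), ← mkₗ_mul, mul_zero]
  mul_assoc x y z := by
    obtain ⟨x, rfl⟩ := mkₗ_surjective N x
    obtain ⟨y, rfl⟩ := mkₗ_surjective N y
    obtain ⟨z, rfl⟩ := mkₗ_surjective N z
    simp only [← mkₗ_mul, mul_assoc]
  norm_mul_le x y := le_of_forall_pos_le_add fun ε hε => by
    have hc : Filter.Tendsto (fun δ : ℝ => (‖x‖ + δ) * (‖y‖ + δ)) (nhdsWithin 0 (Set.Ioi 0))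
        (nhds (‖x‖ * ‖y‖)) := by
      have : Continuous fun δ : ℝ => (‖x‖ + δ) * (‖y‖ + δ) := by fun_prop
      simpa using (this.tendsto 0).mono_left nhdsWithin_le_nhds
    obtain ⟨δ, h1, hδ⟩ := ((hc.eventually (gt_mem_nhds (lt_add_of_pos_right _ hε))).and
      self_mem_nhdsWithin).exists
    obtain ⟨a, rfl, ha⟩ := exists_norm_lt N x hδ
    obtain ⟨b, rfl, hb⟩ := exists_norm_lt N y hδ
    calc ‖mkₗ N a * mkₗ N b‖ ≤ ‖a * b‖ := by rw [← mkₗ_mul]; exact norm_mkₗ_le N _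
      _ ≤ ‖a‖ * ‖b‖ := norm_mul_le _ _
      _ ≤ (‖mkₗ N a‖ + δ) * (‖mkₗ N b‖ + δ) :=
          mul_le_mul ha.le hb.le (norm_nonneg _) ((norm_nonneg _).trans ha.le)
      _ ≤ _ := h1.le

noncomputable instance : NonUnitalCStarAlgebra N.Quotient where
  __ := (inferInstance : NormedSpace ℂ N.Quotient)
  __ := (inferInstance : NonUnitalNormedRing N.Quotient)
  __ := (inferInstance : CompleteSpace N.Quotient)
  star_involutive x := by
    obtain ⟨x, rfl⟩ := mkₗ_surjective N x
    rw [← mkₗ_star, ← mkₗ_star, star_star]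
  star_mul x y := by
    obtain ⟨x, rfl⟩ := mkₗ_surjective N x
    obtain ⟨y, rfl⟩ := mkₗ_surjective N y
    simp only [← mkₗ_star, ← mkₗ_mul, star_mul]
  star_add x y := by
    obtain ⟨x, rfl⟩ := mkₗ_surjective N x
    obtain ⟨y, rfl⟩ := mkₗ_surjective N y
    simp only [← mkₗ_star, ← map_add, star_add]
  norm_mul_self_le x := by
    obtain ⟨x, rfl⟩ := mkₗ_surjective N x
    rw [← mkₗ_star, ← mkₗ_mul]
    refine le_of_forall_pos_le_add fun ε hε => ?_
    obtain ⟨c, hc, hlt⟩ := exists_norm_lt N (mkₗ N (star x * x)) (half_pos hε)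
    have hzN : c - star x * x ∈ N := (mkₗ_eq N).1 hc
    set z := c - star x * x with hz
    obtain ⟨e, he, hes, hle, hx⟩ := N.exists_approx z (N.mul_mem_left _ hzN) (half_pos hε)
    have hx' : ∀ w : A, ‖w - e * w‖ ≤ ‖w‖ := fun w => by
      have := hx (star w)
      rwa [← norm_star, star_sub, star_mul, star_star, hes, norm_star] at this
    have h1 : mkₗ N x = mkₗ N (x - x * e) := (mkₗ_eq N).2 (by
      rw [sub_sub_cancel]; exact N.mul_mem_left _ he)
    have h2 : ‖mkₗ N x‖ ≤ ‖x - x * e‖ := by rw [h1]; exact norm_mkₗ_le N _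
    have h3 : star (x - x * e) * (x - x * e)
        = (c - c * e) - e * (c - c * e) - ((z - z * e) - e * (z - z * e)) := by
      rw [star_sub, star_mul, hes, hz]; noncomm_ring
    calc ‖mkₗ N x‖ * ‖mkₗ N x‖ ≤ ‖x - x * e‖ * ‖x - x * e‖ :=
          mul_le_mul h2 h2 (norm_nonneg _) (norm_nonneg _)
      _ = ‖star (x - x * e) * (x - x * e)‖ := CStarRing.norm_star_mul_self.symm
      _ ≤ ‖(c - c * e) - e * (c - c * e)‖ + ‖(z - z * e) - e * (z - z * e)‖ := by
          rw [h3]; exact norm_sub_le _ _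
      _ ≤ ‖c‖ + ε / 2 := add_le_add ((hx' _).trans (hx c)) ((hx' _).trans hle)
      _ ≤ _ := by linarith
  smul_assoc c x y := by
    obtain ⟨x, rfl⟩ := mkₗ_surjective N x
    obtain ⟨y, rfl⟩ := mkₗ_surjective N y
    simp only [smul_eq_mul, ← map_smul, ← mkₗ_mul, smul_mul_assoc]
  smul_comm c x y := by
    obtain ⟨x, rfl⟩ := mkₗ_surjective N x
    obtain ⟨y, rfl⟩ := mkₗ_surjective N y
    simp only [smul_eq_mul, ← map_smul, ← mkₗ_mul, mul_smul_comm]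
  star_smul c x := by
    obtain ⟨x, rfl⟩ := mkₗ_surjective N x
    simp only [← map_smul, ← mkₗ_star, star_smul]

/-- The canonical ⋆-homomorphism `A → A/N`. -/
noncomputable def mk : A →⋆ₙₐ[ℂ] N.Quotient where
  toFun := mkₗ N
  map_smul' := map_smul (mkₗ N)
  map_zero' := map_zero (mkₗ N)
  map_add' := map_add (mkₗ N)
  map_mul' := mkₗ_mul N
  map_star' := mkₗ_star N

end Quotient

end ClosedIdeal

/-! ### C⋆-completions -/

/-- A complex ⋆-algebra with a C⋆-seminorm. -/
class PreCStarAlgebra (E : Type u) extends NonUnitalSeminormedRing E, StarRing E,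
    NormedSpace ℂ E, IsScalarTower ℂ E E, SMulCommClass ℂ E E, StarModule ℂ E where
  norm_mul_self_le : ∀ x : E, ‖x‖ * ‖x‖ ≤ ‖star x * x‖

/-- The (Hausdorff) completion of a ⋆-algebra with a C⋆-seminorm. -/
def CStarCompletion (E : Type u) [PreCStarAlgebra E] : Type u := UniformSpace.Completion E

namespace CStarCompletion

open UniformSpace UniformSpace.Completion

variable {E : Type u} [PreCStarAlgebra E]

theorem norm_star_le (x : E) : ‖star x‖ ≤ ‖x‖ := by
  have h := PreCStarAlgebra.norm_mul_self_le (star x)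
  rw [star_star] at h
  have h2 := h.trans (norm_mul_le x (star x))
  rcases (norm_nonneg (star x)).eq_or_lt with h0 | h0
  · rw [← h0]; exact norm_nonneg x
  · exact le_of_mul_le_mul_right h2 h0

theorem uniformContinuous_star : UniformContinuous (star : E → E) := by
  refine (LipschitzWith.of_dist_le_mul (K := 1) fun x y => ?_).uniformContinuous
  rw [dist_eq_norm, dist_eq_norm, ← star_sub, NNReal.coe_one, one_mul]
  exact norm_star_le _

noncomputable instance : NormedAddCommGroup (CStarCompletion E) :=
  inferInstanceAs (NormedAddCommGroup (Completion E))

noncomputable instance : NormedSpace ℂ (CStarCompletion E) :=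
  inferInstanceAs (NormedSpace ℂ (Completion E))

instance : CompleteSpace (CStarCompletion E) :=
  inferInstanceAs (CompleteSpace (Completion E))

/-- The canonical linear map into the completion. -/
noncomputable def ofₗ : E →ₗᵢ[ℂ] CStarCompletion E := (toComplₗᵢ : E →ₗᵢ[ℂ] Completion E)

theorem denseRange_ofₗ : DenseRange (ofₗ : E → CStarCompletion E) :=
  denseRange_coe

theorem isDenseInducing_ofₗ : IsDenseInducing (ofₗ : E → CStarCompletion E) :=
  isDenseInducing_coe

noncomputable instance : Mul (CStarCompletion E) where
  mul := Function.curry <| (isDenseInducing_ofₗ.prodMap isDenseInducing_ofₗ).extend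
    (ofₗ ∘ Function.uncurry (fun x y : E => x * y))

noncomputable instance : Star (CStarCompletion E) where
  star := (Completion.map star : Completion E → Completion E)

theorem ofₗ_mul (x y : E) : (ofₗ (x * y) : CStarCompletion E) = ofₗ x * ofₗ y :=
  ((isDenseInducing_ofₗ.prodMap isDenseInducing_ofₗ).extend_eq
    (ofₗ.continuous.comp (continuous_mul : Continuous fun p : E × E => p.1 * p.2)) (x, y)).symm

theorem ofₗ_star (x : E) : (ofₗ (star x) : CStarCompletion E) = star (ofₗ x) :=
  (Completion.map_coe uniformContinuous_star x).symm

instance : ContinuousMul (CStarCompletion E) where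
  continuous_mul := by
    let m : E →+ E →+ CStarCompletion E :=
      (AddMonoidHom.mul : E →+ E →+ E).compr₂ (ofₗ : E →ₗᵢ[ℂ] CStarCompletion E).toLinearMap.toAddMonoidHom
    have : Continuous fun p : E × E => m p.1 p.2 := ofₗ.continuous.comp continuous_mul
    have di : IsDenseInducing (toCompl : E → Completion E) := isDenseInducing_coe
    exact di.extend_Z_bilin di this

theorem continuous_star' : Continuous (star : CStarCompletion E → CStarCompletion E) :=
  Completion.continuous_map

theorem induction₁ {p : CStarCompletion E → Prop} (hc : IsClosed {x | p x})
    (h : ∀ a : E, p (ofₗ a)) (x) : p x :=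
  Completion.induction_on (α := E) x hc h

theorem induction₂ {p : CStarCompletion E → CStarCompletion E → Prop}
    (hc : IsClosed {x : CStarCompletion E × CStarCompletion E | p x.1 x.2})
    (h : ∀ a b : E, p (ofₗ a) (ofₗ b)) (x y) : p x y :=
  Completion.induction_on₂ (α := E) (β := E) x y hc h

theorem induction₃ {p : CStarCompletion E → CStarCompletion E → CStarCompletion E → Prop}
    (hc : IsClosed {x : CStarCompletion E × CStarCompletion E × CStarCompletion E |
      p x.1 x.2.1 x.2.2})
    (h : ∀ a b c : E, p (ofₗ a) (ofₗ b) (ofₗ c)) (x y z) : p x y z :=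
  Completion.induction_on₃ (α := E) (β := E) (γ := E) x y z hc h

noncomputable instance : NonUnitalNormedRing (CStarCompletion E) where
  __ := (inferInstance : NormedAddCommGroup (CStarCompletion E))
  zero_mul := induction₁ (isClosed_eq (by fun_prop) (by fun_prop)) fun a => by
    rw [← map_zero (ofₗ : E →ₗᵢ[ℂ] CStarCompletion E), ← ofₗ_mul, zero_mul]
  mul_zero := induction₁ (isClosed_eq (by fun_prop) (by fun_prop)) fun a => by
    rw [← map_zero (ofₗ : E →ₗᵢ[ℂ] CStarCompletion E), ← ofₗ_mul, mul_zero]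
  left_distrib := induction₃ (isClosed_eq (by fun_prop) (by fun_prop)) fun a b c => by
    rw [← map_add, ← ofₗ_mul, mul_add, map_add, ofₗ_mul, ofₗ_mul]
  right_distrib := induction₃ (isClosed_eq (by fun_prop) (by fun_prop)) fun a b c => by
    rw [← map_add, ← ofₗ_mul, add_mul, map_add, ofₗ_mul, ofₗ_mul]
  mul_assoc := induction₃ (isClosed_eq (by fun_prop) (by fun_prop)) fun a b c => by
    simp only [← ofₗ_mul, mul_assoc]
  norm_mul_le := induction₂ (isClosed_le (by fun_prop) (by fun_prop)) fun a b => by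
    simp only [← ofₗ_mul, LinearIsometry.norm_map]
    exact norm_mul_le a b

theorem smul_mul' (c : ℂ) (x y : CStarCompletion E) : c • x * y = c • (x * y) :=
  induction₂ (p := fun x y => c • x * y = c • (x * y))
    (isClosed_eq ((continuous_fst.const_smul c).mul continuous_snd)
      ((continuous_fst.mul continuous_snd).const_smul c)) (fun a b => by
      simp only [← ofₗ_mul, ← map_smul, smul_mul_assoc]) x y

theorem mul_smul' (c : ℂ) (x y : CStarCompletion E) : x * c • y = c • (x * y) :=
  induction₂ (p := fun x y => x * c • y = c • (x * y))
    (isClosed_eq (continuous_fst.mul (continuous_snd.const_smul c))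
      ((continuous_fst.mul continuous_snd).const_smul c)) (fun a b => by
      simp only [← ofₗ_mul, ← map_smul, mul_smul_comm]) x y

theorem star_star' (x : CStarCompletion E) : star (star x) = x :=
  induction₁ (p := fun x => star (star x) = x)
    (isClosed_eq (continuous_star'.comp continuous_star') continuous_id) (fun a => by
      rw [← ofₗ_star, ← ofₗ_star, star_star]) x

theorem star_mul' (x y : CStarCompletion E) : star (x * y) = star y * star x :=
  induction₂ (p := fun x y => star (x * y) = star y * star x)
    (isClosed_eq (continuous_star'.comp (continuous_fst.mul continuous_snd))
      ((continuous_star'.comp continuous_snd).mul (continuous_star'.comp continuous_fst)))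
    (fun a b => by simp only [← ofₗ_star, ← ofₗ_mul, star_mul]) x y

theorem star_add' (x y : CStarCompletion E) : star (x + y) = star x + star y :=
  induction₂ (p := fun x y => star (x + y) = star x + star y)
    (isClosed_eq (continuous_star'.comp (continuous_fst.add continuous_snd))
      ((continuous_star'.comp continuous_fst).add (continuous_star'.comp continuous_snd)))
    (fun a b => by simp only [← ofₗ_star, ← map_add, star_add]) x y

theorem star_smul' (c : ℂ) (x : CStarCompletion E) : star (c • x) = star c • star x :=
  induction₁ (p := fun x => star (c • x) = star c • star x)
    (isClosed_eq (continuous_star'.comp (continuous_id.const_smul c))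
      ((continuous_const_smul (star c)).comp continuous_star')) (fun a => by
      simp only [← ofₗ_star, ← map_smul, star_smul]) x

theorem norm_mul_self_le' (x : CStarCompletion E) : ‖x‖ * ‖x‖ ≤ ‖star x * x‖ :=
  induction₁ (p := fun x => ‖x‖ * ‖x‖ ≤ ‖star x * x‖)
    (isClosed_le (continuous_norm.mul continuous_norm)
      (continuous_norm.comp (continuous_star'.mul continuous_id))) (fun a => by
      simp only [← ofₗ_star, ← ofₗ_mul, LinearIsometry.norm_map]
      exact PreCStarAlgebra.norm_mul_self_le a) x

noncomputable instance : NonUnitalCStarAlgebra (CStarCompletion E) where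
  __ := (inferInstance : NormedSpace ℂ (CStarCompletion E))
  __ := (inferInstance : NonUnitalNormedRing (CStarCompletion E))
  __ := (inferInstance : CompleteSpace (CStarCompletion E))
  star_involutive := star_star'
  star_mul := star_mul'
  star_add := star_add'
  norm_mul_self_le := norm_mul_self_le'
  smul_assoc := smul_mul'
  smul_comm c x y := (mul_smul' c x y).symm
  star_smul := star_smul'

/-- The canonical ⋆-homomorphism into the completion. -/
noncomputable def of : E →⋆ₙₐ[ℂ] CStarCompletion E where
  toFun := ofₗ
  map_smul' := map_smul ofₗ
  map_zero' := map_zero ofₗ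
  map_add' := map_add ofₗ
  map_mul' := ofₗ_mul
  map_star' := ofₗ_star

end CStarCompletion

/-! ### The maximal tensor product -/

section MaxTensor

theorem exists_star_mul_self_eq {C : Type u} [NonUnitalCStarAlgebra C] (c : C) :
    ∃ d : C, ((‖c‖ * ‖c‖ : ℝ) : ℂ) • (star c * c) - (star c * c) * (star c * c) = star d * d := by
  let _ := CStarAlgebra.spectralOrder C
  have := CStarAlgebra.spectralOrderedRing C
  have h := CStarAlgebra.star_left_conjugate_le_norm_smul (a := c) (b := c * star c)
    (IsSelfAdjoint.mul_star_self c)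
  rw [CStarRing.norm_self_mul_star] at h
  obtain ⟨d, hd⟩ := CStarAlgebra.nonneg_iff_eq_star_mul_self.1 (sub_nonneg.2 h)
  refine ⟨d, ?_⟩
  rw [← hd, Complex.coe_smul]
  simp only [mul_assoc]

/-- Every ⋆-homomorphism on `A ⊙ B` is bounded by the cross norm on elementary tensors. -/
theorem norm_starHom_tmul_le {A : Type u} {B : Type v} {D : Type w} [NonUnitalCStarAlgebra A]
    [NonUnitalCStarAlgebra B] [NonUnitalCStarAlgebra D] (φ : A ⊗[ℂ] B →⋆ₙₐ[ℂ] D) (a : A) (b : B) :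
    ‖φ (a ⊗ₜ b)‖ ≤ ‖a‖ * ‖b‖ := by
  let _ := CStarAlgebra.spectralOrder A
  have := CStarAlgebra.spectralOrderedRing A
  let _ := CStarAlgebra.spectralOrder B
  have := CStarAlgebra.spectralOrderedRing B
  let _ := CStarAlgebra.spectralOrder D
  have := CStarAlgebra.spectralOrderedRing D
  have hpos : ∀ (a : A) (b : B), 0 ≤ φ ((star a * a) ⊗ₜ (star b * b)) := fun a b => by
    have : φ ((star a * a) ⊗ₜ (star b * b)) = star (φ (a ⊗ₜ b)) * φ (a ⊗ₜ b) := by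
      rw [← map_star, ← map_mul, TensorProduct.star_tmul, Algebra.TensorProduct.tmul_mul_tmul]
    rw [this]; exact star_mul_self_nonneg _
  obtain ⟨d, hd⟩ := exists_star_mul_self_eq a
  obtain ⟨e, he⟩ := exists_star_mul_self_eq b
  set x := star a * a with hx
  set y := star b * b with hy
  have hys : star y * y = y * y := by rw [hy]; simp only [star_mul, star_star]
  set z := φ (x ⊗ₜ y) with hz
  have hz0 : 0 ≤ z := hpos a b
  have h1 : 0 ≤ ((‖a‖ * ‖a‖ : ℝ) : ℂ) • φ (x ⊗ₜ (y * y)) - z * z := by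
    have := hpos d y
    rwa [← hd, hys, TensorProduct.sub_tmul, map_sub, ← TensorProduct.smul_tmul', map_smul,
      ← Algebra.TensorProduct.tmul_mul_tmul x x y y, map_mul φ (x ⊗ₜ y)] at this
  have h2 : 0 ≤ ((‖b‖ * ‖b‖ : ℝ) : ℂ) • z - φ (x ⊗ₜ (y * y)) := by
    have := hpos a e
    rwa [← he, TensorProduct.tmul_sub, map_sub, TensorProduct.tmul_smul, map_smul] at this
  have h3 : z * z ≤ (((‖a‖ * ‖a‖) * (‖b‖ * ‖b‖) : ℝ) : ℂ) • z := by
    rw [Complex.coe_smul] at h1 h2 ⊢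
    have h4 := smul_nonneg (mul_self_nonneg ‖a‖) h2
    rw [smul_sub, smul_smul] at h4
    have h5 := add_nonneg h1 h4
    rw [← sub_nonneg]
    convert h5 using 1
    abel
  have h4 : ‖z * z‖ ≤ (‖a‖ * ‖a‖) * (‖b‖ * ‖b‖) * ‖z‖ := by
    have hzz : 0 ≤ z * z := by
      have := star_mul_self_nonneg z
      rwa [(IsSelfAdjoint.of_nonneg hz0).star_eq] at this
    refine (CStarAlgebra.norm_le_norm_of_nonneg_of_le hzz h3).trans ?_
    rw [norm_smul, Complex.norm_real, Real.norm_of_nonneg (by positivity)]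
  have h5 : ‖z * z‖ = ‖z‖ * ‖z‖ := by
    have := CStarRing.norm_star_mul_self (x := z)
    rwa [(IsSelfAdjoint.of_nonneg hz0).star_eq] at this
  have h6 : ‖z‖ ≤ (‖a‖ * ‖a‖) * (‖b‖ * ‖b‖) := by
    rw [h5] at h4
    rcases (norm_nonneg z).eq_or_lt with h0 | h0
    · rw [← h0]; positivity
    · exact le_of_mul_le_mul_right h4 h0
  have h7 : z = star (φ (a ⊗ₜ b)) * φ (a ⊗ₜ b) := by
    rw [← map_star, ← map_mul, TensorProduct.star_tmul, Algebra.TensorProduct.tmul_mul_tmul]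
  rw [h7, CStarRing.norm_star_mul_self] at h6
  exact le_of_sq_le_sq (by nlinarith) (by positivity)

/-- The maximal C⋆-seminorm on the algebraic tensor product: the supremum of `‖φ x‖` over all
⋆-homomorphisms `φ` from `A ⊙ B` to C⋆-algebras. -/
noncomputable def maxNorm {A : Type u} {B : Type v} [NonUnitalCStarAlgebra A]
    [NonUnitalCStarAlgebra B] (x : A ⊗[ℂ] B) : ℝ :=
  sSup {r : ℝ | ∃ (D : Type (max u v)) (_ : NonUnitalCStarAlgebra D)
    (φ : A ⊗[ℂ] B →⋆ₙₐ[ℂ] D), r = ‖φ x‖}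

variable {A : Type u} {B : Type v} [NonUnitalCStarAlgebra A] [NonUnitalCStarAlgebra B]

theorem maxNorm_bddAbove (x : A ⊗[ℂ] B) :
    BddAbove {r : ℝ | ∃ (D : Type (max u v)) (_ : NonUnitalCStarAlgebra D)
      (φ : A ⊗[ℂ] B →⋆ₙₐ[ℂ] D), r = ‖φ x‖} := by
  suffices ∃ C : ℝ, ∀ (D : Type (max u v)) (_ : NonUnitalCStarAlgebra D)
      (φ : A ⊗[ℂ] B →⋆ₙₐ[ℂ] D), ‖φ x‖ ≤ C by
    obtain ⟨C, hC⟩ := this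
    refine ⟨C, ?_⟩
    rintro _ ⟨D, _, φ, rfl⟩
    exact hC D _ φ
  induction x with
  | zero => exact ⟨0, fun D _ φ => by rw [map_zero, norm_zero]⟩
  | tmul a b => exact ⟨‖a‖ * ‖b‖, fun D _ φ => norm_starHom_tmul_le φ a b⟩
  | add x y hx hy =>
    obtain ⟨C, hC⟩ := hx
    obtain ⟨C', hC'⟩ := hy
    refine ⟨C + C', fun D _ φ => ?_⟩
    rw [map_add]
    exact (norm_add_le _ _).trans (add_le_add (hC D _ φ) (hC' D _ φ))

theorem le_maxNorm {D : Type (max u v)} [NonUnitalCStarAlgebra D] (φ : A ⊗[ℂ] B →⋆ₙₐ[ℂ] D)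
    (x : A ⊗[ℂ] B) : ‖φ x‖ ≤ maxNorm x :=
  le_csSup (maxNorm_bddAbove x) ⟨D, _, φ, rfl⟩

theorem maxNorm_le (x : A ⊗[ℂ] B) {C : ℝ} (hC : 0 ≤ C) (h : ∀ (D : Type (max u v))
    (_ : NonUnitalCStarAlgebra D) (φ : A ⊗[ℂ] B →⋆ₙₐ[ℂ] D), ‖φ x‖ ≤ C) : maxNorm x ≤ C := by
  refine Real.sSup_le ?_ hC
  rintro _ ⟨D, _, φ, rfl⟩
  exact h D _ φ

theorem maxNorm_nonneg (x : A ⊗[ℂ] B) : 0 ≤ maxNorm x := by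
  refine Real.sSup_nonneg ?_
  rintro _ ⟨D, _, φ, rfl⟩
  exact norm_nonneg _

theorem maxNorm_add_le (x y : A ⊗[ℂ] B) : maxNorm (x + y) ≤ maxNorm x + maxNorm y :=
  maxNorm_le _ (add_nonneg (maxNorm_nonneg _) (maxNorm_nonneg _)) fun D _ φ => by
    rw [map_add]
    exact (norm_add_le _ _).trans (add_le_add (le_maxNorm φ _) (le_maxNorm φ _))

theorem maxNorm_mul_le (x y : A ⊗[ℂ] B) : maxNorm (x * y) ≤ maxNorm x * maxNorm y :=
  maxNorm_le _ (mul_nonneg (maxNorm_nonneg _) (maxNorm_nonneg _)) fun D _ φ => by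
    rw [map_mul]
    exact (norm_mul_le _ _).trans
      (mul_le_mul (le_maxNorm φ _) (le_maxNorm φ _) (norm_nonneg _) (maxNorm_nonneg _))

theorem maxNorm_smul_le (c : ℂ) (x : A ⊗[ℂ] B) : maxNorm (c • x) ≤ ‖c‖ * maxNorm x :=
  maxNorm_le _ (mul_nonneg (norm_nonneg _) (maxNorm_nonneg _)) fun D _ φ => by
    rw [map_smul, norm_smul]
    exact mul_le_mul_of_nonneg_left (le_maxNorm φ x) (norm_nonneg c)

theorem maxNorm_smul (c : ℂ) (x : A ⊗[ℂ] B) : maxNorm (c • x) = ‖c‖ * maxNorm x := by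
  refine le_antisymm (maxNorm_smul_le c x) ?_
  rcases eq_or_ne c 0 with rfl | hc
  · rw [norm_zero, zero_mul]; exact maxNorm_nonneg _
  · have h := maxNorm_smul_le c⁻¹ (c • x)
    rw [smul_smul, inv_mul_cancel₀ hc, one_smul, norm_inv] at h
    rwa [← le_inv_mul_iff₀ (norm_pos_iff.2 hc)]

theorem maxNorm_mul_self_le (x : A ⊗[ℂ] B) : maxNorm x * maxNorm x ≤ maxNorm (star x * x) := by
  have h : maxNorm x ≤ Real.sqrt (maxNorm (star x * x)) :=
    maxNorm_le _ (Real.sqrt_nonneg _) fun D _ φ => by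
      refine Real.le_sqrt_of_sq_le ?_
      rw [sq, ← CStarRing.norm_star_mul_self, ← map_star, ← map_mul]
      exact le_maxNorm φ _
  have h2 := mul_self_le_mul_self (maxNorm_nonneg x) h
  rwa [Real.mul_self_sqrt (maxNorm_nonneg _)] at h2

variable (A B) in
/-- The algebraic tensor product `A ⊙ B`, regarded as a ⋆-algebra with the maximal C⋆-seminorm. -/
def PreMaxTensor : Type (max u v) := A ⊗[ℂ] B

namespace PreMaxTensor

noncomputable instance : AddCommGroup (PreMaxTensor A B) :=
  inferInstanceAs (AddCommGroup (A ⊗[ℂ] B))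

noncomputable instance : NonUnitalRing (PreMaxTensor A B) where
  __ := (inferInstance : AddCommGroup (PreMaxTensor A B))
  __ := (inferInstance : NonUnitalSemiring (A ⊗[ℂ] B))

noncomputable instance : StarRing (PreMaxTensor A B) :=
  inferInstanceAs (StarRing (A ⊗[ℂ] B))

noncomputable instance : Module ℂ (PreMaxTensor A B) :=
  inferInstanceAs (Module ℂ (A ⊗[ℂ] B))

instance : IsScalarTower ℂ (PreMaxTensor A B) (PreMaxTensor A B) :=
  inferInstanceAs (IsScalarTower ℂ (A ⊗[ℂ] B) (A ⊗[ℂ] B))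

instance : SMulCommClass ℂ (PreMaxTensor A B) (PreMaxTensor A B) :=
  inferInstanceAs (SMulCommClass ℂ (A ⊗[ℂ] B) (A ⊗[ℂ] B))

instance : StarModule ℂ (PreMaxTensor A B) :=
  inferInstanceAs (StarModule ℂ (A ⊗[ℂ] B))

noncomputable instance : Norm (PreMaxTensor A B) where
  norm x := maxNorm (x : A ⊗[ℂ] B)

theorem core : SeminormedSpace.Core ℂ (PreMaxTensor A B) where
  norm_nonneg := maxNorm_nonneg
  norm_triangle := maxNorm_add_le
  norm_smul := maxNorm_smul

noncomputable instance : SeminormedAddCommGroup (PreMaxTensor A B) :=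
  SeminormedAddCommGroup.ofCore (core (A := A) (B := B))

noncomputable instance : PreCStarAlgebra (PreMaxTensor A B) where
  __ := (inferInstance : SeminormedAddCommGroup (PreMaxTensor A B))
  __ := (inferInstance : NonUnitalRing (PreMaxTensor A B))
  __ := (inferInstance : StarRing (PreMaxTensor A B))
  __ := (inferInstance : Module ℂ (PreMaxTensor A B))
  norm_smul_le c x := (core.norm_smul c x).le
  smul_assoc := smul_assoc
  smul_comm := smul_comm
  star_smul := star_smul
  norm_mul_le := maxNorm_mul_le
  norm_mul_self_le := maxNorm_mul_self_le

end PreMaxTensor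

variable (A B) in
/-- The maximal tensor product of two C⋆-algebras: the completion of `A ⊙ B` in the maximal
norm. -/
abbrev MaxTensor : Type (max u v) := CStarCompletion (PreMaxTensor A B)

/-- The canonical ⋆-homomorphism `A ⊙ B → A ⊗_max B`. -/
noncomputable def MaxTensor.of : A ⊗[ℂ] B →⋆ₙₐ[ℂ] MaxTensor A B where
  toFun x := CStarCompletion.of (E := PreMaxTensor A B) x
  map_smul' := map_smul (CStarCompletion.of (E := PreMaxTensor A B))
  map_zero' := map_zero (CStarCompletion.of (E := PreMaxTensor A B))
  map_add' := map_add (CStarCompletion.of (E := PreMaxTensor A B))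
  map_mul' := map_mul (CStarCompletion.of (E := PreMaxTensor A B))
  map_star' := map_star (CStarCompletion.of (E := PreMaxTensor A B))

/-- `MaxTensor.of` as a linear map. -/
noncomputable def MaxTensor.ofₗ : A ⊗[ℂ] B →ₗ[ℂ] MaxTensor A B where
  toFun := MaxTensor.of
  map_add' := map_add _
  map_smul' := map_smul _

theorem MaxTensor.norm_of (x : A ⊗[ℂ] B) : ‖MaxTensor.of x‖ = maxNorm x :=
  LinearIsometry.norm_map (CStarCompletion.ofₗ (E := PreMaxTensor A B)) x

theorem MaxTensor.denseRange_of : DenseRange (MaxTensor.of : A ⊗[ℂ] B → MaxTensor A B) :=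
  CStarCompletion.denseRange_ofₗ (E := PreMaxTensor A B)

end MaxTensor

/-! ### Compatible actions -/

/-- A C⋆-algebra `A` that is an `𝔄`-bimodule with a compatible (bounded) action of the
C⋆-algebra `𝔄`. Here `left α a` is `α · a` and `right α a` is `a · α`. -/
structure CompatibleAction (𝔄 : Type w) (A : Type u) [NonUnitalCStarAlgebra 𝔄]
    [NonUnitalCStarAlgebra A] where
  left : 𝔄 →ₗ[ℂ] A →ₗ[ℂ] A
  right : 𝔄 →ₗ[ℂ] A →ₗ[ℂ] A
  mul_left : ∀ α β a, left (α * β) a = left α (left β a)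
  mul_right : ∀ α β a, right (α * β) a = right β (right α a)
  left_right : ∀ α β a, right β (left α a) = left α (right β a)
  bound : ∃ k : ℝ, 0 < k ∧ ∀ α a, ‖left α a‖ ≤ k * ‖a‖ * ‖α‖ ∧ ‖right α a‖ ≤ k * ‖a‖ * ‖α‖
  left_mul : ∀ α a b, left α (a * b) = left α a * b
  right_mul : ∀ α a b, right α (a * b) = a * right α b
  star_left : ∀ α a, star (left α a) = right (star α) (star a)
  star_right : ∀ α a, star (right α a) = left (star α) (star a)

namespace CompatibleAction

variable {𝔄 : Type w} {A : Type u} {B : Type v} [NonUnitalCStarAlgebra 𝔄]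
  [NonUnitalCStarAlgebra A] [NonUnitalCStarAlgebra B]

/-- The action of `𝔄` on `A` is right-trivial with respect to the character `f`:
`a · α = f(α) a`. -/
def IsRightTrivial (act : CompatibleAction 𝔄 A) (f : WeakDual.characterSpace ℂ 𝔄) : Prop :=
  ∀ (α : 𝔄) (a : A), act.right α a = f α • a

theorem right_mem (act : CompatibleAction 𝔄 A) (N : ClosedIdeal A) (α : 𝔄) {n : A} (hn : n ∈ N) :
    act.right α n ∈ N := N.mem_of_approx fun ε hε => by
  obtain ⟨k, hk, hb⟩ := act.bound
  obtain ⟨e, -, -, hle, -⟩ := N.exists_approx n (N.mul_mem_left _ hn)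
    (ε := ε / (k * (‖α‖ + 1))) (by positivity)
  refine ⟨act.right α (n * e), by rw [act.right_mul]; exact N.mul_mem_right _ hn, ?_⟩
  rw [← map_sub]
  calc _ ≤ k * ‖n - n * e‖ * ‖α‖ := (hb _ _).2
    _ ≤ k * (ε / (k * (‖α‖ + 1))) * (‖α‖ + 1) := by gcongr; linarith
    _ = ε := by field_simp

theorem left_mem (act : CompatibleAction 𝔄 A) (N : ClosedIdeal A) (α : 𝔄) {n : A} (hn : n ∈ N) :
    act.left α n ∈ N := by
  have h := act.right_mem N (star α) (star_mem hn)
  have h2 := star_mem h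
  rwa [act.star_right, star_star, star_star] at h2

/-- The restriction of the action to a closed two-sided ideal. -/
noncomputable def restrict (act : CompatibleAction 𝔄 A) (N : ClosedIdeal A) : CompatibleAction 𝔄 N where
  left := LinearMap.mk₂ ℂ (fun α n => ⟨act.left α n, act.left_mem N α n.2⟩)
    (fun _ _ _ => Subtype.ext (by simp)) (fun _ _ _ => Subtype.ext (by simp))
    (fun _ _ _ => Subtype.ext (by simp)) (fun _ _ _ => Subtype.ext (by simp))
  right := LinearMap.mk₂ ℂ (fun α n => ⟨act.right α n, act.right_mem N α n.2⟩)
    (fun _ _ _ => Subtype.ext (by simp)) (fun _ _ _ => Subtype.ext (by simp))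
    (fun _ _ _ => Subtype.ext (by simp)) (fun _ _ _ => Subtype.ext (by simp))
  mul_left _ _ _ := Subtype.ext (act.mul_left _ _ _)
  mul_right _ _ _ := Subtype.ext (act.mul_right _ _ _)
  left_right _ _ _ := Subtype.ext (act.left_right _ _ _)
  bound := by
    obtain ⟨k, hk, hb⟩ := act.bound
    exact ⟨k, hk, fun α n => hb α n⟩
  left_mul _ _ _ := Subtype.ext (act.left_mul _ _ _)
  right_mul _ _ _ := Subtype.ext (act.right_mul _ _ _)
  star_left _ _ := Subtype.ext (act.star_left _ _)
  star_right _ _ := Subtype.ext (act.star_right _ _)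

theorem norm_le_of_lift (N : ClosedIdeal A) {T : A →ₗ[ℂ] A} {T' : N.Quotient →ₗ[ℂ] N.Quotient}
    (h : ∀ a, T' (ClosedIdeal.Quotient.mkₗ N a) = ClosedIdeal.Quotient.mkₗ N (T a)) {k c : ℝ}
    (hk : 0 ≤ k) (hc : 0 ≤ c) (hb : ∀ a, ‖T a‖ ≤ k * ‖a‖ * c) (x : N.Quotient) :
    ‖T' x‖ ≤ k * ‖x‖ * c := by
  refine le_of_forall_pos_le_add fun ε hε => ?_
  obtain ⟨a, rfl, ha⟩ := ClosedIdeal.Quotient.exists_norm_lt N x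
    (ε := ε / (k * c + 1)) (by positivity)
  set r := ‖ClosedIdeal.Quotient.mkₗ N a‖
  have hkc : 0 ≤ k * c := mul_nonneg hk hc
  calc _ ≤ ‖T a‖ := by rw [h]; exact ClosedIdeal.Quotient.norm_mkₗ_le N _
    _ ≤ k * ‖a‖ * c := hb a
    _ ≤ k * (r + ε / (k * c + 1)) * c := by gcongr
    _ = k * r * c + ε * ((k * c) / (k * c + 1)) := by ring
    _ ≤ k * r * c + ε * 1 := by
      gcongr
      rw [div_le_one (by positivity)]
      linarith
    _ = _ := by rw [mul_one]

/-- A bilinear action leaving a closed ideal invariant descends to the quotient. -/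
def quotientBilin (N : ClosedIdeal A) (F : 𝔄 →ₗ[ℂ] A →ₗ[ℂ] A)
    (hF : ∀ α n, n ∈ N → F α n ∈ N) : 𝔄 →ₗ[ℂ] N.Quotient →ₗ[ℂ] N.Quotient where
  toFun α := N.toSubmodule.mapQ N.toSubmodule (F α) (hF α)
  map_add' α β := by
    ext x
    obtain ⟨a, rfl⟩ := ClosedIdeal.Quotient.mkₗ_surjective N x
    exact congrArg (ClosedIdeal.Quotient.mkₗ N) (LinearMap.congr_fun (map_add F α β) a)
  map_smul' c α := by
    ext x
    obtain ⟨a, rfl⟩ := ClosedIdeal.Quotient.mkₗ_surjective N x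
    exact congrArg (ClosedIdeal.Quotient.mkₗ N) (LinearMap.congr_fun (map_smul F c α) a)

theorem quotientBilin_mk (N : ClosedIdeal A) (F : 𝔄 →ₗ[ℂ] A →ₗ[ℂ] A)
    (hF : ∀ α n, n ∈ N → F α n ∈ N) (α : 𝔄) (a : A) :
    quotientBilin N F hF α (ClosedIdeal.Quotient.mkₗ N a)
      = ClosedIdeal.Quotient.mkₗ N (F α a) := rfl

/-- The induced action on the quotient by a closed two-sided ideal. -/
def quotient (act : CompatibleAction 𝔄 A) (N : ClosedIdeal A) :
    CompatibleAction 𝔄 N.Quotient where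
  left := quotientBilin N act.left fun α _ hn => act.left_mem N α hn
  right := quotientBilin N act.right fun α _ hn => act.right_mem N α hn
  mul_left α β x := by
    obtain ⟨a, rfl⟩ := ClosedIdeal.Quotient.mkₗ_surjective N x
    simp only [quotientBilin_mk, act.mul_left]
  mul_right α β x := by
    obtain ⟨a, rfl⟩ := ClosedIdeal.Quotient.mkₗ_surjective N x
    simp only [quotientBilin_mk, act.mul_right]
  left_right α β x := by
    obtain ⟨a, rfl⟩ := ClosedIdeal.Quotient.mkₗ_surjective N x
    simp only [quotientBilin_mk, act.left_right]
  bound := by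
    obtain ⟨k, hk, hb⟩ := act.bound
    exact ⟨k, hk, fun α x =>
      ⟨norm_le_of_lift N (fun a => quotientBilin_mk N _ _ α a) hk.le (norm_nonneg α)
        (fun a => (hb α a).1) x,
      norm_le_of_lift N (fun a => quotientBilin_mk N _ _ α a) hk.le (norm_nonneg α)
        (fun a => (hb α a).2) x⟩⟩
  left_mul α x y := by
    obtain ⟨a, rfl⟩ := ClosedIdeal.Quotient.mkₗ_surjective N x
    obtain ⟨b, rfl⟩ := ClosedIdeal.Quotient.mkₗ_surjective N y
    simp only [← ClosedIdeal.Quotient.mkₗ_mul, quotientBilin_mk, act.left_mul]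
  right_mul α x y := by
    obtain ⟨a, rfl⟩ := ClosedIdeal.Quotient.mkₗ_surjective N x
    obtain ⟨b, rfl⟩ := ClosedIdeal.Quotient.mkₗ_surjective N y
    simp only [← ClosedIdeal.Quotient.mkₗ_mul, quotientBilin_mk, act.right_mul]
  star_left α x := by
    obtain ⟨a, rfl⟩ := ClosedIdeal.Quotient.mkₗ_surjective N x
    simp only [← ClosedIdeal.Quotient.mkₗ_star, quotientBilin_mk, act.star_left]
  star_right α x := by
    obtain ⟨a, rfl⟩ := ClosedIdeal.Quotient.mkₗ_surjective N x
    simp only [← ClosedIdeal.Quotient.mkₗ_star, quotientBilin_mk, act.star_right]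

/-! ### The module tensor product -/

/-- The two-sided ideal `I` of `A ⊙ B` generated by the elements `a·α ⊗ b - a ⊗ α·b`. -/
def balancedIdeal (actA : CompatibleAction 𝔄 A) (actB : CompatibleAction 𝔄 B) :
    Submodule ℂ (A ⊗[ℂ] B) :=
  sInf {J | (∀ α a b, actA.right α a ⊗ₜ b - a ⊗ₜ actB.left α b ∈ J) ∧
    ∀ x, ∀ y ∈ J, x * y ∈ J ∧ y * x ∈ J}

theorem balancedIdeal_mul_mem (actA : CompatibleAction 𝔄 A) (actB : CompatibleAction 𝔄 B)
    (x : A ⊗[ℂ] B) {y : A ⊗[ℂ] B} (hy : y ∈ balancedIdeal actA actB) :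
    x * y ∈ balancedIdeal actA actB ∧ y * x ∈ balancedIdeal actA actB := by
  simp only [balancedIdeal, Submodule.mem_sInf] at hy ⊢
  exact ⟨fun J hJ => (hJ.2 x y (hy J hJ)).1, fun J hJ => (hJ.2 x y (hy J hJ)).2⟩

/-- The closure of `I` in `A ⊗_max B`. -/
noncomputable def maxBalancedIdeal (actA : CompatibleAction 𝔄 A) (actB : CompatibleAction 𝔄 B) :
    ClosedIdeal (MaxTensor A B) where
  toSubmodule := ((balancedIdeal actA actB).map MaxTensor.ofₗ).topologicalClosure
  mul_mem_left' a x hx := by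
    refine map_mem_closure₂ (f := fun x y : MaxTensor A B => x * y) continuous_mul (MaxTensor.denseRange_of a) hx ?_
    rintro _ ⟨s, rfl⟩ _ ⟨t, ht, rfl⟩
    exact ⟨s * t, (balancedIdeal_mul_mem actA actB s ht).1, map_mul MaxTensor.of s t⟩
  mul_mem_right' a x hx := by
    refine map_mem_closure₂ (f := fun x y : MaxTensor A B => x * y) continuous_mul hx (MaxTensor.denseRange_of a) ?_
    rintro _ ⟨t, ht, rfl⟩ _ ⟨s, rfl⟩
    exact ⟨t * s, (balancedIdeal_mul_mem actA actB s ht).2, map_mul MaxTensor.of t s⟩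
  isClosed' := Submodule.isClosed_topologicalClosure _

end CompatibleAction

/-- The `𝔄`-module maximal tensor product `A ⊗_{𝔄,max} B`, i.e. the Hausdorff completion of
`(A ⊙ B)/I` in the quotient of the maximal norm, realized as `(A ⊗_max B)/I_max` with `I_max` the
closure of `I`; see `ModuleMaxTensor.norm_of` and `ModuleMaxTensor.denseRange_of`. -/
abbrev ModuleMaxTensor {𝔄 : Type w} {A : Type u} {B : Type v} [NonUnitalCStarAlgebra 𝔄]
    [NonUnitalCStarAlgebra A] [NonUnitalCStarAlgebra B]
    (actA : CompatibleAction 𝔄 A) (actB : CompatibleAction 𝔄 B) : Type (max u v) :=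
  (CompatibleAction.maxBalancedIdeal actA actB).Quotient

namespace ModuleMaxTensor

variable {𝔄 : Type w} {A : Type u} {B : Type v} [NonUnitalCStarAlgebra 𝔄]
  [NonUnitalCStarAlgebra A] [NonUnitalCStarAlgebra B]
  (actA : CompatibleAction 𝔄 A) (actB : CompatibleAction 𝔄 B)

/-- The canonical ⋆-homomorphism `A ⊙ B → A ⊗_{𝔄,max} B`. -/
noncomputable def of : A ⊗[ℂ] B →⋆ₙₐ[ℂ] ModuleMaxTensor actA actB :=
  (ClosedIdeal.Quotient.mk (CompatibleAction.maxBalancedIdeal actA actB)).comp MaxTensor.of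

/-- The image of the elementary tensor `a ⊗ b` in `A ⊗_{𝔄,max} B`. -/
noncomputable def tmul (a : A) (b : B) : ModuleMaxTensor actA actB := of actA actB (a ⊗ₜ b)

theorem denseRange_of : DenseRange (of actA actB) := by
  refine (ClosedIdeal.Quotient.mkₗ_surjective _).denseRange.comp MaxTensor.denseRange_of ?_
  exact AddMonoidHomClass.continuous_of_bound (ClosedIdeal.Quotient.mkₗ _) 1 fun x => by
    rw [one_mul]; exact ClosedIdeal.Quotient.norm_mkₗ_le _ x

theorem norm_of (x : A ⊗[ℂ] B) :
    ‖of actA actB x‖ = ⨅ i : CompatibleAction.balancedIdeal actA actB, maxNorm (x + (i : A ⊗[ℂ] B)) := by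
  refine le_antisymm (le_ciInf fun i => ?_) (le_of_forall_pos_le_add fun ε hε => ?_)
  · have hi : (MaxTensor.of (i : A ⊗[ℂ] B) : MaxTensor A B) ∈
        CompatibleAction.maxBalancedIdeal actA actB :=
      subset_closure ⟨i, i.2, rfl⟩
    have h : of actA actB x = of actA actB (x + (i : A ⊗[ℂ] B)) :=
      (ClosedIdeal.Quotient.mkₗ_eq _).2 (by
        have h' : (MaxTensor.of x : MaxTensor A B) - MaxTensor.of (x + (i : A ⊗[ℂ] B))
            = -MaxTensor.of (i : A ⊗[ℂ] B) := by rw [map_add, sub_add_cancel_left]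
        have h'' := neg_mem hi
        rwa [← h'] at h'')
    rw [h, ← MaxTensor.norm_of]
    exact ClosedIdeal.Quotient.norm_mkₗ_le _ _
  · obtain ⟨y, hy, hlt⟩ := ClosedIdeal.Quotient.exists_norm_lt _ (of actA actB x) (half_pos hε)
    have hyx : y - MaxTensor.of x ∈ CompatibleAction.maxBalancedIdeal actA actB :=
      (ClosedIdeal.Quotient.mkₗ_eq _).1 hy
    obtain ⟨_, ⟨i, hi, rfl⟩, hdist⟩ := Metric.mem_closure_iff.1 hyx _ (half_pos hε)
    have hb : BddBelow (Set.range fun i : CompatibleAction.balancedIdeal actA actB =>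
        maxNorm (x + (i : A ⊗[ℂ] B))) := ⟨0, by rintro _ ⟨j, rfl⟩; exact maxNorm_nonneg _⟩
    refine (ciInf_le hb ⟨i, hi⟩).trans ?_
    have h2 : (MaxTensor.of (x + i) : MaxTensor A B)
        = y - (y - MaxTensor.of x - MaxTensor.of i) := by
      rw [map_add]; abel
    rw [← MaxTensor.norm_of, h2]
    rw [dist_eq_norm] at hdist
    have h3 := norm_sub_le y (y - MaxTensor.of x - MaxTensor.of i)
    have h4 : ‖y - MaxTensor.of x - (MaxTensor.of i : MaxTensor A B)‖ < ε / 2 := hdist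
    linarith

end ModuleMaxTensor

/-! Taking adjoints in `a · α = f(α) a` gives `α · a = f(α) a`, because characters of a C⋆-algebra
preserve the involution. As both actions use the same character, every generator `a·α ⊗ b - a ⊗ α·b`
is zero. So the balanced ideal is trivial (`IsRightTrivial.balancedIdeal_eq_bot`), the norm on the
module tensor product is the maximal norm (`IsRightTrivial.norm_of`), and the theorem becomes the
exactness of the maximal tensor product.

The analytic point is that the maximal norm of `A ⊙ B` restricts to that of `N ⊙ B`
(`ClosedIdeal.maxNorm_rTensor_incl`). No representation is extended from the ideal. Instead, `A ⊙ B`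
acts on `N ⊙ B` by left multiplication. An approximate unit of `N` shows that this action is bounded
in the maximal norm (`exists_tensorMulLeft_le`), and its operator seminorm is a C⋆-seminorm
(`norm_tensorMulLeftCLM_mul_self_le`), hence at most the maximal norm of `A ⊙ B`. Letting `x` in `N
⊙ B` act on `star x` recovers the maximal norm of `x` in `N ⊙ B`.

Exactness in the middle and on the right comes from universal properties. The map from `A ⊙ B` to
the quotient by the closed ideal `K = range ι` kills `N ⊙ B`, which is the kernel of `A ⊙ B → A/N ⊙
B`. It therefore descends to `A/N ⊙ B` and extends to the completion, giving an inverse of the map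
that `q` induces on the quotient by `K`. Surjectivity of `q` and the identification of its kernel
follow from this inverse. -/

/-! ### Extending ⋆-homomorphisms -/

/-- A ⋆-homomorphism dominated in norm by a ⋆-homomorphism with dense range factors through the
latter. -/
theorem NonUnitalStarAlgHom.exists_extend {E T D : Type*} [NonUnitalRing E] [StarRing E]
    [Module ℂ E] [NonUnitalCStarAlgebra T] [NonUnitalCStarAlgebra D] (i : E →⋆ₙₐ[ℂ] T)
    (hi : DenseRange i) (φ : E →⋆ₙₐ[ℂ] D) (h : ∀ x, ‖φ x‖ ≤ ‖i x‖) :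
    ∃ Φ : T →⋆ₙₐ[ℂ] D, ∀ x, Φ (i x) = φ x := by
  let e : E →ₗ[ℂ] T := ⟨⟨i, map_add i⟩, map_smul i⟩
  let g : E →ₗ[ℂ] D := ⟨⟨φ, map_add φ⟩, map_smul φ⟩
  have he : ∀ x, g.extendOfNorm e (i x) = φ x :=
    LinearMap.extendOfNorm_eq (f := g) (e := e) hi ⟨1, fun x => by rw [one_mul]; exact h x⟩
  set F : T →L[ℂ] D := g.extendOfNorm e
  refine ⟨{ toFun := F, map_smul' := map_smul F, map_zero' := map_zero F, map_add' := map_add F,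
            map_mul' := ?_, map_star' := ?_ }, he⟩
  · intro x y
    refine hi.induction_on₂ (p := fun x y => F (x * y) = F x * F y)
      (isClosed_eq (by fun_prop) (by fun_prop)) (fun s t => ?_) x y
    rw [← map_mul, he, he, he, map_mul]
  · intro x
    refine hi.induction_on (p := fun x => F (star x) = star (F x)) x
      (isClosed_eq (by fun_prop) (by fun_prop)) (fun s => ?_)
    rw [← map_star, he, he, map_star]

/-- A ⋆-homomorphism vanishing on the kernel of a surjective ⋆-homomorphism factors through the
latter. -/
theorem NonUnitalStarAlgHom.exists_factor {E F D : Type*} [NonUnitalRing E] [StarRing E]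
    [Module ℂ E] [NonUnitalRing F] [StarRing F] [Module ℂ F] [NonUnitalRing D] [StarRing D]
    [Module ℂ D] (p : E →⋆ₙₐ[ℂ] F) (hp : Function.Surjective p) (g : E →⋆ₙₐ[ℂ] D)
    (h : ∀ x, p x = 0 → g x = 0) : ∃ G : F →⋆ₙₐ[ℂ] D, ∀ x, G (p x) = g x := by
  -- The chosen section need not be a homomorphism, but `g` does not see the choice of preimage.
  -- Each law can then be checked on elements of the form `p x`.
  have key : ∀ x, g (Function.surjInv hp (p x)) = g x := fun x => by
    rw [← sub_eq_zero, ← map_sub]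
    exact h _ (by rw [map_sub, Function.surjInv_eq hp, sub_self])
  refine ⟨{ toFun := fun y => g (Function.surjInv hp y), map_smul' := ?_, map_zero' := ?_,
            map_add' := ?_, map_mul' := ?_, map_star' := ?_ }, key⟩
  · intro c y
    obtain ⟨x, rfl⟩ := hp y
    have := key (c • x)
    rw [map_smul] at this
    rw [MonoidHom.id_apply, this, key, map_smul]
  · change g (Function.surjInv hp 0) = 0
    rw [← map_zero p, key, map_zero]
  · intro y z
    obtain ⟨x, rfl⟩ := hp y
    obtain ⟨x', rfl⟩ := hp z
    change g (Function.surjInv hp (p x + p x')) = _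
    rw [← map_add, key, map_add, key, key]
  · intro y z
    obtain ⟨x, rfl⟩ := hp y
    obtain ⟨x', rfl⟩ := hp z
    rw [← map_mul, key, map_mul, key, key]
  · intro y
    obtain ⟨x, rfl⟩ := hp y
    rw [← map_star, key, map_star, key]

theorem NonUnitalStarAlgHom.continuous_of_cstarAlgebra {A B : Type*} [NonUnitalCStarAlgebra A]
    [NonUnitalCStarAlgebra B] (φ : A →⋆ₙₐ[ℂ] B) : Continuous φ :=
  AddMonoidHomClass.continuous_of_bound φ 1 fun x => by
    rw [one_mul]; exact NonUnitalStarAlgHom.norm_apply_le φ x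

/-! ### Functoriality of the algebraic tensor product in the first variable -/

section TensorMap

variable {A A' : Type u} {B : Type v} [NonUnitalCStarAlgebra A] [NonUnitalCStarAlgebra A']
  [NonUnitalCStarAlgebra B]

variable (B) in
/-- The ⋆-homomorphism `φ ⊗ id : A ⊙ B → A' ⊙ B`. -/
noncomputable def NonUnitalStarAlgHom.rTensor (φ : A →⋆ₙₐ[ℂ] A') : A ⊗[ℂ] B →⋆ₙₐ[ℂ] A' ⊗[ℂ] B where
  toFun := LinearMap.rTensor B (φ : A →ₗ[ℂ] A')
  map_smul' := map_smul _
  map_zero' := map_zero _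
  map_add' := map_add _
  map_mul' x y := by
    induction x with
    | zero => simp only [zero_mul, map_zero]
    | add x x' hx hx' => simp only [add_mul, map_add, hx, hx']
    | tmul a b =>
      induction y with
      | zero => simp only [mul_zero, map_zero]
      | add y y' hy hy' => simp only [mul_add, map_add, hy, hy']
      | tmul a' b' =>
        simp only [Algebra.TensorProduct.tmul_mul_tmul, LinearMap.rTensor_tmul]
        exact congrArg (· ⊗ₜ[ℂ] (b * b')) (map_mul φ a a')
  map_star' x := by
    induction x with
    | zero => simp only [star_zero, map_zero]
    | add x x' hx hx' => simp only [star_add, map_add, hx, hx']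
    | tmul a b =>
      simp only [TensorProduct.star_tmul, LinearMap.rTensor_tmul]
      exact congrArg (· ⊗ₜ[ℂ] star b) (map_star φ a)

theorem NonUnitalStarAlgHom.rTensor_tmul (φ : A →⋆ₙₐ[ℂ] A') (a : A) (b : B) :
    φ.rTensor B (a ⊗ₜ b) = φ a ⊗ₜ b := rfl

theorem NonUnitalStarAlgHom.rTensor_surjective {φ : A →⋆ₙₐ[ℂ] A'} (h : Function.Surjective φ) :
    Function.Surjective (φ.rTensor B) :=
  LinearMap.rTensor_surjective B (g := (φ : A →ₗ[ℂ] A')) h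

/-- Modules over a field are flat. -/
theorem NonUnitalStarAlgHom.rTensor_injective {φ : A →⋆ₙₐ[ℂ] A'} (h : Function.Injective φ) :
    Function.Injective (φ.rTensor B) :=
  Module.Flat.rTensor_preserves_injective_linearMap (φ : A →ₗ[ℂ] A') h

theorem maxNorm_tmul_le (a : A) (b : B) : maxNorm (a ⊗ₜ[ℂ] b) ≤ ‖a‖ * ‖b‖ :=
  maxNorm_le _ (by positivity) fun _ _ φ => norm_starHom_tmul_le φ a b

/-- Each ⋆-homomorphism on `A' ⊙ B` pulls back along `φ ⊗ id` to one on `A ⊙ B`, so it already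
counts in the supremum on the right. -/
theorem maxNorm_rTensor_le (φ : A →⋆ₙₐ[ℂ] A') (x : A ⊗[ℂ] B) :
    maxNorm (φ.rTensor B x) ≤ maxNorm x :=
  maxNorm_le _ (maxNorm_nonneg _) fun _ _ ψ => le_maxNorm (ψ.comp (φ.rTensor B)) x

end TensorMap

/-! ### The action of `A ⊙ B` on `N ⊙ B` -/

namespace ClosedIdeal

variable {A : Type u} {B : Type v} [NonUnitalCStarAlgebra A] [NonUnitalCStarAlgebra B]
  (N : ClosedIdeal A)

/-- The inclusion of a closed ideal, as a ⋆-homomorphism. -/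
noncomputable def incl : N →⋆ₙₐ[ℂ] A where
  toFun n := n
  map_smul' _ _ := rfl
  map_zero' := rfl
  map_add' _ _ := rfl
  map_mul' _ _ := rfl
  map_star' _ := rfl

theorem incl_injective : Function.Injective N.incl := Subtype.coe_injective

/-- Left multiplication of `A` on a closed ideal. -/
noncomputable def mulLeft : A →ₗ[ℂ] N →ₗ[ℂ] N :=
  LinearMap.mk₂ ℂ (fun a n => ⟨a * n, N.mul_mem_left a n.2⟩)
    (fun _ _ _ => Subtype.ext (add_mul _ _ _)) (fun _ _ _ => Subtype.ext (smul_mul_assoc _ _ _))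
    (fun _ _ _ => Subtype.ext (mul_add _ _ _)) (fun _ _ _ => Subtype.ext (mul_smul_comm _ _ _))

variable (B) in
/-- Left multiplication of `A ⊙ B` on `N ⊙ B`. -/
noncomputable def tensorMulLeft : A ⊗[ℂ] B →ₗ[ℂ] N ⊗[ℂ] B →ₗ[ℂ] N ⊗[ℂ] B :=
  TensorProduct.map₂ N.mulLeft (LinearMap.mul ℂ B)

theorem tensorMulLeft_tmul (a : A) (b : B) (n : N) (b' : B) :
    N.tensorMulLeft B (a ⊗ₜ b) (n ⊗ₜ b') = N.mulLeft a n ⊗ₜ (b * b') := rfl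

/-- Seen inside `A ⊙ B`, the action is plain multiplication. Since `N ⊙ B` embeds there, identities
for the action reduce to ring identities in `A ⊙ B`. -/
theorem rTensor_tensorMulLeft (x : A ⊗[ℂ] B) (y : N ⊗[ℂ] B) :
    N.incl.rTensor B (N.tensorMulLeft B x y) = x * N.incl.rTensor B y := by
  induction x with
  | zero => simp only [map_zero, LinearMap.zero_apply, zero_mul]
  | add x x' hx hx' => simp only [map_add, LinearMap.add_apply, add_mul, hx, hx']
  | tmul a b =>
    induction y with
    | zero => simp only [map_zero, mul_zero]
    | add y y' hy hy' => simp only [map_add, mul_add, hy, hy']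
    | tmul n b' =>
      rw [tensorMulLeft_tmul, NonUnitalStarAlgHom.rTensor_tmul, NonUnitalStarAlgHom.rTensor_tmul,
        Algebra.TensorProduct.tmul_mul_tmul]
      rfl

theorem rTensor_incl_injective : Function.Injective (N.incl.rTensor B) :=
  NonUnitalStarAlgHom.rTensor_injective N.incl_injective

theorem tensorMulLeft_mul (x x' : A ⊗[ℂ] B) (y : N ⊗[ℂ] B) :
    N.tensorMulLeft B (x * x') y = N.tensorMulLeft B x (N.tensorMulLeft B x' y) :=
  N.rTensor_incl_injective (by simp only [rTensor_tensorMulLeft, mul_assoc])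

theorem tensorMulLeft_rTensor (x y : N ⊗[ℂ] B) :
    N.tensorMulLeft B (N.incl.rTensor B x) y = x * y :=
  N.rTensor_incl_injective (by simp only [rTensor_tensorMulLeft, map_mul])

/-- With `star y * z` as an inner product valued in `N ⊙ B`, this says that the adjoint of the
action of `x` is the action of `star x`. -/
theorem star_tensorMulLeft_mul (x : A ⊗[ℂ] B) (y : N ⊗[ℂ] B) :
    star (N.tensorMulLeft B x y) * N.tensorMulLeft B x y
      = star y * N.tensorMulLeft B (star x * x) y :=
  N.rTensor_incl_injective (by
    simp only [rTensor_tensorMulLeft, map_mul, map_star, star_mul, mul_assoc])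

/-- On `n ⊗ b'` the error is `a (n - e n) ⊗ b b'`, which vanishes in the limit because `e n → n`.
The action of an element outside `N ⊙ B` thus becomes a limit of multiplications inside it. -/
theorem tendsto_approx_tensorMulLeft [PartialOrder N] [StarOrderedRing N] (a : A) (b : B) (y : N ⊗[ℂ] B) :
    Filter.Tendsto (fun e : N => maxNorm (N.tensorMulLeft B (a ⊗ₜ b) y - (N.mulLeft a e ⊗ₜ b) * y))
      (CStarAlgebra.approximateUnit N) (nhds 0) := by
  have hl := CStarAlgebra.increasingApproximateUnit N
  induction y with
  | zero =>
    have h0 : maxNorm (0 : N ⊗[ℂ] B) = 0 := by simpa using maxNorm_smul (0 : ℂ) (0 : N ⊗[ℂ] B)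
    simpa only [map_zero, mul_zero, sub_zero, h0] using tendsto_const_nhds
  | add y y' hy hy' =>
    refine squeeze_zero (fun _ => maxNorm_nonneg _) (fun e => ?_) (by simpa using hy.add hy')
    rw [map_add, mul_add, add_sub_add_comm]
    exact maxNorm_add_le _ _
  | tmul n b' =>
    have h1 : Filter.Tendsto (fun e : N => ‖a‖ * ‖n - e * n‖ * ‖b * b'‖)
        (CStarAlgebra.approximateUnit N) (nhds 0) := by
      simpa using (((tendsto_const_nhds (x := n)).sub (hl.tendsto_mul_right n)).norm.const_mul
        ‖a‖).mul_const ‖b * b'‖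
    refine squeeze_zero (fun _ => maxNorm_nonneg _) (fun e => ?_) h1
    have h2 : N.tensorMulLeft B (a ⊗ₜ b) (n ⊗ₜ b') - (N.mulLeft a e ⊗ₜ b) * (n ⊗ₜ[ℂ] b')
        = N.mulLeft a (n - e * n) ⊗ₜ (b * b') := by
      rw [tensorMulLeft_tmul, Algebra.TensorProduct.tmul_mul_tmul, ← TensorProduct.sub_tmul,
        map_sub]
      congr 2
      exact Subtype.ext (mul_assoc a (e : A) (n : A))
    rw [h2]
    refine (maxNorm_tmul_le _ _).trans ?_
    gcongr
    exact norm_mul_le a ((n - e * n : N) : A)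

/-- For `x = a ⊗ b` the approximants `a e ⊗ b` lie in `N ⊙ B` and have maximal norm at most `‖a‖
‖b‖`, so submultiplicativity there passes to the limit. -/
theorem exists_tensorMulLeft_le (x : A ⊗[ℂ] B) :
    ∃ C : ℝ, ∀ y, maxNorm (N.tensorMulLeft B x y) ≤ C * maxNorm y := by
  induction x with
  | zero =>
    refine ⟨1, fun y => ?_⟩
    have h0 : maxNorm (0 : N ⊗[ℂ] B) = 0 := by simpa using maxNorm_smul (0 : ℂ) (0 : N ⊗[ℂ] B)
    rw [map_zero, LinearMap.zero_apply, h0, one_mul]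
    exact maxNorm_nonneg _
  | add x x' hx hx' =>
    obtain ⟨C, hC⟩ := hx
    obtain ⟨C', hC'⟩ := hx'
    refine ⟨C + C', fun y => ?_⟩
    rw [map_add, LinearMap.add_apply, add_mul]
    exact (maxNorm_add_le _ _).trans (add_le_add (hC y) (hC' y))
  | tmul a b =>
    refine ⟨‖a‖ * ‖b‖, fun y => ?_⟩
    let _ := CStarAlgebra.spectralOrder N
    have := CStarAlgebra.spectralOrderedRing N
    have ht := N.tendsto_approx_tensorMulLeft a b y
    have hl := CStarAlgebra.increasingApproximateUnit N
    have := hl.neBot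
    refine ge_of_tendsto (by simpa using ht.add_const (‖a‖ * ‖b‖ * maxNorm y)) ?_
    -- Eventually `‖e‖ ≤ 1`, which keeps the constant independent of `e`.
    filter_upwards [hl.eventually_norm] with e he
    have h1 : maxNorm ((N.mulLeft a e ⊗ₜ b) * y) ≤ ‖a‖ * ‖b‖ * maxNorm y := by
      refine (maxNorm_mul_le _ _).trans (mul_le_mul_of_nonneg_right ?_ (maxNorm_nonneg _))
      refine (maxNorm_tmul_le _ _).trans (mul_le_mul_of_nonneg_right ?_ (norm_nonneg _))
      calc ‖N.mulLeft a e‖ ≤ ‖a‖ * ‖e‖ := norm_mul_le a (e : A)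
        _ ≤ ‖a‖ * 1 := by gcongr
        _ = ‖a‖ := mul_one _
    have h2 := maxNorm_add_le (N.tensorMulLeft B (a ⊗ₜ b) y - (N.mulLeft a e ⊗ₜ b) * y)
      ((N.mulLeft a e ⊗ₜ b) * y)
    rw [sub_add_cancel] at h2
    linarith

/-! ### The operator seminorm of `A ⊙ B` on `N ⊙ B` -/

variable (B) in
/-- The action of `A ⊙ B` on `N ⊙ B` by bounded operators in the maximal norm. -/
noncomputable def tensorMulLeftCLM :
    A ⊗[ℂ] B →ₙₐ[ℂ] (PreMaxTensor N B →L[ℂ] PreMaxTensor N B) where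
  toFun x := LinearMap.mkContinuousOfExistsBound
    (N.tensorMulLeft B x : PreMaxTensor N B →ₗ[ℂ] PreMaxTensor N B) (N.exists_tensorMulLeft_le x)
  map_smul' c x := ContinuousLinearMap.ext fun y =>
    LinearMap.congr_fun (map_smul (N.tensorMulLeft B) c x) y
  map_zero' := ContinuousLinearMap.ext fun y =>
    LinearMap.congr_fun (map_zero (N.tensorMulLeft B)) y
  map_add' x x' := ContinuousLinearMap.ext fun y =>
    LinearMap.congr_fun (map_add (N.tensorMulLeft B) x x') y
  map_mul' x x' := ContinuousLinearMap.ext fun y => N.tensorMulLeft_mul x x' y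

/-- The usual Hilbert space argument works with `star y * z` as inner product: `‖T y‖² ≤ ‖star y * S
y‖ ≤ ‖S‖ ‖y‖²`. -/
theorem norm_tensorMulLeftCLM_mul_self_le (x : A ⊗[ℂ] B) :
    ‖N.tensorMulLeftCLM B x‖ * ‖N.tensorMulLeftCLM B x‖ ≤ ‖N.tensorMulLeftCLM B (star x * x)‖ := by
  set T := N.tensorMulLeftCLM B x
  set S := N.tensorMulLeftCLM B (star x * x)
  have hS : 0 ≤ ‖S‖ := norm_nonneg S
  have h : ‖T‖ ≤ Real.sqrt ‖S‖ := T.opNorm_le_bound (Real.sqrt_nonneg _) fun y => by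
    refine le_of_sq_le_sq ?_ (by positivity)
    rw [mul_pow, Real.sq_sqrt hS]
    calc ‖T y‖ ^ 2 ≤ ‖star (T y) * T y‖ := by
          rw [sq]; exact PreCStarAlgebra.norm_mul_self_le _
      _ = ‖star y * S y‖ := congrArg norm (N.star_tensorMulLeft_mul x y)
      _ ≤ ‖star y‖ * ‖S y‖ := norm_mul_le _ _
      _ ≤ ‖y‖ * (‖S‖ * ‖y‖) := mul_le_mul (CStarCompletion.norm_star_le y) (S.le_opNorm y)
          (norm_nonneg _) (norm_nonneg _)
      _ = ‖S‖ * ‖y‖ ^ 2 := by ring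
  have h2 := mul_self_le_mul_self (norm_nonneg T) h
  rwa [Real.mul_self_sqrt hS] at h2

variable (B) in
/-- The algebraic tensor product `A ⊙ B` with the operator seminorm of its action on `N ⊙ B`. -/
def PreOpTensor (_ : ClosedIdeal A) : Type (max u v) := A ⊗[ℂ] B

namespace PreOpTensor

noncomputable instance : NonUnitalRing (N.PreOpTensor B) :=
  inferInstanceAs (NonUnitalRing (PreMaxTensor A B))

noncomputable instance : StarRing (N.PreOpTensor B) :=
  inferInstanceAs (StarRing (PreMaxTensor A B))

noncomputable instance : Module ℂ (N.PreOpTensor B) :=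
  inferInstanceAs (Module ℂ (PreMaxTensor A B))

instance : IsScalarTower ℂ (N.PreOpTensor B) (N.PreOpTensor B) :=
  inferInstanceAs (IsScalarTower ℂ (PreMaxTensor A B) (PreMaxTensor A B))

instance : SMulCommClass ℂ (N.PreOpTensor B) (N.PreOpTensor B) :=
  inferInstanceAs (SMulCommClass ℂ (PreMaxTensor A B) (PreMaxTensor A B))

instance : StarModule ℂ (N.PreOpTensor B) :=
  inferInstanceAs (StarModule ℂ (PreMaxTensor A B))

variable (B) in
/-- The defining action of `PreOpTensor`. -/
noncomputable def toCLM : N.PreOpTensor B →ₙₐ[ℂ] (PreMaxTensor N B →L[ℂ] PreMaxTensor N B) where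
  toFun x := N.tensorMulLeftCLM B x
  map_smul' := map_smul (N.tensorMulLeftCLM B)
  map_zero' := map_zero (N.tensorMulLeftCLM B)
  map_add' := map_add (N.tensorMulLeftCLM B)
  map_mul' := map_mul (N.tensorMulLeftCLM B)

noncomputable instance : NonUnitalSeminormedRing (N.PreOpTensor B) :=
  NonUnitalSeminormedRing.induced _ _ (toCLM B N)

noncomputable instance : PreCStarAlgebra (N.PreOpTensor B) where
  __ := (inferInstance : NonUnitalSeminormedRing (N.PreOpTensor B))
  __ := (inferInstance : StarRing (N.PreOpTensor B))
  __ := (inferInstance : Module ℂ (N.PreOpTensor B))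
  norm_smul_le c x := by
    change ‖toCLM B N (c • x)‖ ≤ ‖c‖ * ‖toCLM B N x‖
    rw [map_smul]
    exact ContinuousLinearMap.opNorm_smul_le c (toCLM B N x)
  smul_assoc := smul_assoc
  smul_comm := smul_comm
  star_smul := star_smul
  norm_mul_self_le := N.norm_tensorMulLeftCLM_mul_self_le

end PreOpTensor

/-- Completing `A ⊙ B` in the operator seminorm gives a C⋆-algebra, and the canonical map into it is
one of the ⋆-homomorphisms in the supremum defining `maxNorm`. -/
theorem norm_tensorMulLeftCLM_le (x : A ⊗[ℂ] B) : ‖N.tensorMulLeftCLM B x‖ ≤ maxNorm x := by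
  let φ : A ⊗[ℂ] B →⋆ₙₐ[ℂ] CStarCompletion (N.PreOpTensor B) :=
    { toFun := fun x => CStarCompletion.of (E := N.PreOpTensor B) x
      map_smul' := map_smul (CStarCompletion.of (E := N.PreOpTensor B))
      map_zero' := map_zero (CStarCompletion.of (E := N.PreOpTensor B))
      map_add' := map_add (CStarCompletion.of (E := N.PreOpTensor B))
      map_mul' := map_mul (CStarCompletion.of (E := N.PreOpTensor B))
      map_star' := map_star (CStarCompletion.of (E := N.PreOpTensor B)) }
  have h : ‖φ x‖ = ‖N.tensorMulLeftCLM B x‖ :=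
    LinearIsometry.norm_map (CStarCompletion.ofₗ (E := N.PreOpTensor B)) x
  rw [← h]
  exact le_maxNorm φ x

/-- The maximal norm of `A ⊙ B` restricts to the maximal norm of `N ⊙ B`. -/
theorem maxNorm_rTensor_incl (x : N ⊗[ℂ] B) : maxNorm (N.incl.rTensor B x) = maxNorm x := by
  refine le_antisymm (maxNorm_rTensor_le _ _) ?_
  -- The operator of `x`, evaluated at `star x`, gives `x * star x`. The C⋆-inequality for `star x`
  -- bounds this below by `‖star x‖²`, and one factor `‖star x‖` cancels unless it is zero.
  have h1 : maxNorm (x * star x) ≤ maxNorm (N.incl.rTensor B x) * maxNorm (star x) := by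
    have h := ((N.tensorMulLeftCLM B (N.incl.rTensor B x)).le_opNorm
      (star x : N ⊗[ℂ] B)).trans (mul_le_mul_of_nonneg_right
        (N.norm_tensorMulLeftCLM_le _) (norm_nonneg _))
    have h2 : N.tensorMulLeftCLM B (N.incl.rTensor B x) (star x : N ⊗[ℂ] B) = x * star x :=
      N.tensorMulLeft_rTensor x (star x)
    rw [h2] at h
    exact h
  have h2 : maxNorm (star x) * maxNorm (star x) ≤ maxNorm (x * star x) := by
    simpa using maxNorm_mul_self_le (star x)
  have h3 : maxNorm x ≤ maxNorm (star x) := by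
    have := CStarCompletion.norm_star_le (E := PreMaxTensor N B) (star x : N ⊗[ℂ] B)
    change maxNorm (star (star x)) ≤ maxNorm (star x) at this
    rwa [star_star] at this
  rcases (maxNorm_nonneg (star x)).eq_or_lt with h0 | h0
  · rw [← h0] at h3
    exact h3.trans (maxNorm_nonneg _)
  · exact h3.trans (le_of_mul_le_mul_right (h2.trans h1) h0)

/-! ### Exactness of the algebraic sequence -/

/-- Right exactness of the algebraic tensor product, applied to `N → A → A/N → 0` before any
completion. -/
theorem rTensor_mk_eq_zero {x : A ⊗[ℂ] B} (hx : (Quotient.mk N).rTensor B x = 0) :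
    ∃ y, N.incl.rTensor B y = x := by
  have h : Function.Exact (N.incl : N →ₗ[ℂ] A) (Quotient.mk N : A →ₗ[ℂ] N.Quotient) := fun a =>
    (Quotient.mkₗ_eq_zero N).trans ⟨fun h => ⟨⟨a, h⟩, rfl⟩, by rintro ⟨n, rfl⟩; exact n.2⟩
  exact (rTensor_exact B h (Quotient.mkₗ_surjective N) x).1 hx

theorem rTensor_mk_rTensor_incl (y : N ⊗[ℂ] B) :
    (Quotient.mk N).rTensor B (N.incl.rTensor B y) = 0 := by
  induction y with
  | zero => simp only [map_zero]
  | add y y' hy hy' => rw [map_add, map_add, hy, hy', add_zero]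
  | tmul n b =>
    rw [NonUnitalStarAlgHom.rTensor_tmul, NonUnitalStarAlgHom.rTensor_tmul]
    have : Quotient.mk N (N.incl n) = 0 := (Quotient.mkₗ_eq_zero N).2 n.2
    rw [this, TensorProduct.zero_tmul]

end ClosedIdeal

/-! ### Right-trivial actions -/

/-- The character extends to a unital one on the unitization, and unital characters of C⋆-algebras
are ⋆-preserving. -/
theorem WeakDual.CharacterSpace.apply_star {𝔄 : Type*} [NonUnitalCStarAlgebra 𝔄]
    (f : WeakDual.characterSpace ℂ 𝔄) (α : 𝔄) : f (star α) = star (f α) := by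
  have h := AlgHomClass.instStarHomClass (F := Unitization ℂ 𝔄 →ₐ[ℂ] ℂ)
  have h2 := h.map_star
    (Unitization.lift (WeakDual.CharacterSpace.toNonUnitalAlgHom f)) (α : Unitization ℂ 𝔄)
  rw [← Unitization.inr_star] at h2
  simpa using h2

namespace CompatibleAction

variable {𝔄 : Type w} {A : Type u} {B : Type v} [NonUnitalCStarAlgebra 𝔄]
  [NonUnitalCStarAlgebra A] [NonUnitalCStarAlgebra B] {f : WeakDual.characterSpace ℂ 𝔄}
  {actA : CompatibleAction 𝔄 A} {actB : CompatibleAction 𝔄 B}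

/-- Conjugating `a* · α* = f(α*) a*` exchanges the two actions, and the two complex conjugations on
the scalar cancel. -/
theorem IsRightTrivial.left_apply (h : actA.IsRightTrivial f) (α : 𝔄) (a : A) :
    actA.left α a = f α • a := by
  have h2 := actA.star_right (star α) (star a)
  rwa [h, star_smul, star_star, star_star, WeakDual.CharacterSpace.apply_star, star_star,
    eq_comm] at h2

theorem IsRightTrivial.restrict (h : actA.IsRightTrivial f) (N : ClosedIdeal A) :
    (actA.restrict N).IsRightTrivial f := fun α n => Subtype.ext (h α n)

theorem IsRightTrivial.quotient (h : actA.IsRightTrivial f) (N : ClosedIdeal A) :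
    (actA.quotient N).IsRightTrivial f := fun α x => by
  obtain ⟨a, rfl⟩ := ClosedIdeal.Quotient.mkₗ_surjective N x
  rw [← map_smul, ← h]
  rfl

/-- Both terms of a generator equal `f(α) (a ⊗ b)`; this needs the same character on `A` and on `B`.
-/
theorem IsRightTrivial.balancedIdeal_eq_bot (hA : actA.IsRightTrivial f)
    (hB : actB.IsRightTrivial f) : balancedIdeal actA actB = ⊥ := by
  refine eq_bot_iff.2 (sInf_le ⟨fun α a b => ?_, fun x y hy => ?_⟩)
  · rw [hA, hB.left_apply, TensorProduct.tmul_smul, ← TensorProduct.smul_tmul', sub_self]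
    exact Submodule.zero_mem _
  · rw [(Submodule.mem_bot ℂ).1 hy, mul_zero, zero_mul]
    exact ⟨Submodule.zero_mem _, Submodule.zero_mem _⟩

/-- The infimum defining the quotient norm runs over the zero ideal only. From here on, `𝔄` plays no
role in the norm. -/
theorem IsRightTrivial.norm_of (hA : actA.IsRightTrivial f) (hB : actB.IsRightTrivial f)
    (x : A ⊗[ℂ] B) : ‖ModuleMaxTensor.of actA actB x‖ = maxNorm x := by
  rw [ModuleMaxTensor.norm_of, hA.balancedIdeal_eq_bot hB, ciInf_unique,
    (Submodule.mem_bot ℂ).1 (default : (⊥ : Submodule ℂ (A ⊗[ℂ] B))).2, add_zero]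

end CompatibleAction

/-! ### Maps between module tensor products -/

namespace ModuleMaxTensor

open CompatibleAction

variable {𝔄 : Type w} {A : Type u} {B : Type v} [NonUnitalCStarAlgebra 𝔄]
  [NonUnitalCStarAlgebra A] [NonUnitalCStarAlgebra B] {f : WeakDual.characterSpace ℂ 𝔄}
  {actA : CompatibleAction 𝔄 A} {actB : CompatibleAction 𝔄 B}

/-- The universal property for right-trivial actions. -/
theorem exists_lift (hA : actA.IsRightTrivial f) (hB : actB.IsRightTrivial f)
    {D : Type (max u v)} [NonUnitalCStarAlgebra D] (φ : A ⊗[ℂ] B →⋆ₙₐ[ℂ] D) :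
    ∃ Φ : ModuleMaxTensor actA actB →⋆ₙₐ[ℂ] D, ∀ x, Φ (of actA actB x) = φ x :=
  (of actA actB).exists_extend (denseRange_of actA actB) φ fun x => by
    rw [hA.norm_of hB]; exact le_maxNorm φ x

/-- The canonical map `N ⊗ B → A ⊗ B` is isometric. -/
theorem exists_incl (hA : actA.IsRightTrivial f) (hB : actB.IsRightTrivial f) (N : ClosedIdeal A) :
    ∃ ι : ModuleMaxTensor (actA.restrict N) actB →⋆ₙₐ[ℂ] ModuleMaxTensor actA actB,
      (∀ x, ι (of (actA.restrict N) actB x) = of actA actB (N.incl.rTensor B x)) ∧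
      Isometry ι := by
  obtain ⟨ι, hι⟩ := exists_lift (hA.restrict N) hB ((of actA actB).comp (N.incl.rTensor B))
  refine ⟨ι, hι, AddMonoidHomClass.isometry_of_norm ι fun x => ?_⟩
  refine (denseRange_of (actA.restrict N) actB).induction_on (p := fun x => ‖ι x‖ = ‖x‖) x
    (isClosed_eq ι.continuous_of_cstarAlgebra.norm continuous_norm) fun y => ?_
  rw [hι, (hA.restrict N).norm_of hB]
  exact (hA.norm_of hB _).trans (N.maxNorm_rTensor_incl y)

/-- The range of the canonical map `N ⊗ B → A ⊗ B` is a closed ideal. -/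
theorem exists_closedIdeal_eq_range (N : ClosedIdeal A)
    (ι : ModuleMaxTensor (actA.restrict N) actB →⋆ₙₐ[ℂ] ModuleMaxTensor actA actB)
    (hι : ∀ x, ι (of (actA.restrict N) actB x) = of actA actB (N.incl.rTensor B x))
    (hiso : Isometry ι) :
    ∃ K : ClosedIdeal (ModuleMaxTensor actA actB),
      (K : Set (ModuleMaxTensor actA actB)) = Set.range ι := by
  have hcl : IsClosed (Set.range ι) := hiso.isClosedEmbedding.isClosed_range
  -- The range is closed, so density in both variables reduces this to algebraic tensors, where the
  -- product comes from the action of `A ⊙ B` on `N ⊙ B`.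
  have hmul : ∀ a y, a * ι y ∈ Set.range ι := fun a y => by
    refine (denseRange_of actA actB).induction_on (p := fun a => a * ι y ∈ Set.range ι) a
      (hcl.preimage (by fun_prop)) fun s => ?_
    refine (denseRange_of (actA.restrict N) actB).induction_on
      (p := fun y => of actA actB s * ι y ∈ Set.range ι) y
      (hcl.preimage (continuous_const.mul ι.continuous_of_cstarAlgebra)) fun t => ?_
    exact ⟨of (actA.restrict N) actB (N.tensorMulLeft B s t), by
      rw [hι, hι, N.rTensor_tensorMulLeft, map_mul]⟩
  refine ⟨{ carrier := Set.range ι, add_mem' := ?_, zero_mem' := ⟨0, map_zero ι⟩, smul_mem' := ?_,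
            mul_mem_left' := ?_, mul_mem_right' := ?_, isClosed' := hcl }, rfl⟩
  · rintro _ _ ⟨x, rfl⟩ ⟨y, rfl⟩
    exact ⟨x + y, map_add ι x y⟩
  · rintro c _ ⟨x, rfl⟩
    exact ⟨c • x, map_smul ι c x⟩
  · rintro a _ ⟨x, rfl⟩
    exact hmul a x
  · rintro a _ ⟨x, rfl⟩
    -- Right multiplication follows from left multiplication by taking adjoints.
    obtain ⟨y, hy⟩ := hmul (star a) (star x)
    exact ⟨star y, by rw [map_star, hy, map_star, star_mul, star_star, star_star]⟩

end ModuleMaxTensor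

/-! ### The exact sequence and the quotient isomorphism -/

open ModuleMaxTensor in
theorem mainTheorem9 {𝔄 : Type w} {A : Type u} {B : Type v} [NonUnitalCStarAlgebra 𝔄]
    [NonUnitalCStarAlgebra A] [NonUnitalCStarAlgebra B]
    (actA : CompatibleAction 𝔄 A) (actB : CompatibleAction 𝔄 B)
    (f : WeakDual.characterSpace ℂ 𝔄)
    (hA : actA.IsRightTrivial f) (hB : actB.IsRightTrivial f) (N : ClosedIdeal A) :
    ∃ (ι : ModuleMaxTensor (actA.restrict N) actB →⋆ₙₐ[ℂ] ModuleMaxTensor actA actB)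
      (q : ModuleMaxTensor actA actB →⋆ₙₐ[ℂ] ModuleMaxTensor (actA.quotient N) actB)
      (K : ClosedIdeal (ModuleMaxTensor actA actB))
      (Φ : ModuleMaxTensor (actA.quotient N) actB ≃⋆ₐ[ℂ] K.Quotient),
      (∀ (n : N) (b : B), ι (ModuleMaxTensor.tmul (actA.restrict N) actB n b)
        = ModuleMaxTensor.tmul actA actB n b) ∧
      (∀ (a : A) (b : B), q (ModuleMaxTensor.tmul actA actB a b)
        = ModuleMaxTensor.tmul (actA.quotient N) actB (ClosedIdeal.Quotient.mk N a) b) ∧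
      Isometry ι ∧
      Function.Surjective q ∧
      (∀ x, q x = 0 ↔ x ∈ Set.range ι) ∧
      (K : Set (ModuleMaxTensor actA actB)) = Set.range ι ∧
      Isometry Φ ∧
      (∀ (a : A) (b : B),
        Φ (ModuleMaxTensor.tmul (actA.quotient N) actB (ClosedIdeal.Quotient.mk N a) b)
          = ClosedIdeal.Quotient.mk K (ModuleMaxTensor.tmul actA actB a b)) := by
  obtain ⟨ι, hι, hiso⟩ := exists_incl hA hB N
  obtain ⟨K, hK⟩ := exists_closedIdeal_eq_range N ι hι hiso
  have hKmem : ∀ x, x ∈ K ↔ x ∈ Set.range ι := fun x => by rw [← hK]; rfl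
  obtain ⟨q, hq⟩ := exists_lift hA hB
    ((of (actA.quotient N) actB).comp ((ClosedIdeal.Quotient.mk N).rTensor B))
  replace hq : ∀ x, q (of actA actB x)
      = of (actA.quotient N) actB ((ClosedIdeal.Quotient.mk N).rTensor B x) := hq
  have hqι : ∀ y, q (ι y) = 0 := fun y =>
    (denseRange_of (actA.restrict N) actB).induction_on (p := fun y => q (ι y) = 0) y
      (isClosed_eq (q.continuous_of_cstarAlgebra.comp ι.continuous_of_cstarAlgebra)
        continuous_const) fun t => by
      rw [hι, hq, N.rTensor_mk_rTensor_incl, map_zero]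
  have hmkK : Function.Surjective (ClosedIdeal.Quotient.mk K) :=
    ClosedIdeal.Quotient.mkₗ_surjective K
  have hmkK0 : ∀ x, ClosedIdeal.Quotient.mk K x = 0 ↔ x ∈ Set.range ι := fun x =>
    (ClosedIdeal.Quotient.mkₗ_eq_zero K).trans (hKmem x)
  -- `Ψ` is the map induced by `q` on the quotient by `K`; it exists because `q` vanishes on the
  -- range of `ι`.
  obtain ⟨Ψ, hΨ⟩ := (ClosedIdeal.Quotient.mk K).exists_factor hmkK q fun x hx => by
    obtain ⟨y, rfl⟩ := (hmkK0 x).1 hx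
    exact hqι y
  have hπ : Function.Surjective ((ClosedIdeal.Quotient.mk N).rTensor B) :=
    NonUnitalStarAlgHom.rTensor_surjective (ClosedIdeal.Quotient.mkₗ_surjective N)
  -- The candidate inverse is built on `A/N ⊙ B` first: by algebraic exactness, the kernel of `A ⊙ B
  -- → A/N ⊙ B` is sent by `ι` into `K`. Its target is a C⋆-algebra, so maximality of the norm makes
  -- it extend to `Φ`.
  obtain ⟨ψ, hψ⟩ := ((ClosedIdeal.Quotient.mk N).rTensor B).exists_factor hπ
    ((ClosedIdeal.Quotient.mk K).comp (of actA actB)) fun x hx => by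
    obtain ⟨y, rfl⟩ := N.rTensor_mk_eq_zero hx
    exact (hmkK0 _).2 ⟨_, hι y⟩
  obtain ⟨Φ, hΦ⟩ := exists_lift (hA.quotient N) hB ψ
  have hΦq : ∀ x, Φ (q x) = ClosedIdeal.Quotient.mk K x := fun x =>
    (denseRange_of actA actB).induction_on (p := fun x => Φ (q x) = ClosedIdeal.Quotient.mk K x) x
      (isClosed_eq (Φ.continuous_of_cstarAlgebra.comp q.continuous_of_cstarAlgebra)
        (ClosedIdeal.Quotient.mk K).continuous_of_cstarAlgebra) fun t => by
      rw [hq, hΦ]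
      exact hψ t
  have hΦΨ : ∀ x, Φ (Ψ x) = x := fun x => by
    obtain ⟨t, rfl⟩ := hmkK x
    rw [hΨ, hΦq]
  have hΨΦ : ∀ x, Ψ (Φ x) = x := fun x =>
    (denseRange_of (actA.quotient N) actB).induction_on (p := fun x => Ψ (Φ x) = x) x
      (isClosed_eq (Ψ.continuous_of_cstarAlgebra.comp Φ.continuous_of_cstarAlgebra)
        continuous_id) fun s => by
      obtain ⟨t, rfl⟩ := hπ s
      rw [← hq, hΦq, hΨ]
  let e : ModuleMaxTensor (actA.quotient N) actB ≃⋆ₐ[ℂ] K.Quotient :=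
    { toFun := Φ, invFun := Ψ, left_inv := hΨΦ, right_inv := hΦΨ, map_mul' := map_mul Φ,
      map_add' := map_add Φ, map_star' := map_star Φ, map_smul' := map_smul Φ }
  -- The isometry of `Φ` is automatic, since ⋆-isomorphisms of C⋆-algebras preserve the norm.
  refine ⟨ι, q, K, e, fun n b => hι _, fun a b => hq _, hiso, fun x => ?_, fun x => ⟨fun h => ?_, ?_⟩,
    hK, StarAlgEquiv.isometry e, fun a b => ?_⟩
  -- A lift `t` of `Φ x` satisfies `q t = Ψ (Φ x) = x`.
  · obtain ⟨t, ht⟩ := hmkK (Φ x)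
    exact ⟨t, by rw [← hΨ, ht, hΨΦ]⟩
  -- The quotient map by `K` factors through `q`, so the kernel of `q` lies in `K`.
  · rw [← hmkK0, ← hΦq, h, map_zero]
  · rintro ⟨y, rfl⟩
    exact hqι y
  · change Φ (of _ _ _) = _
    rw [hΦ]
    exact hψ (a ⊗ₜ b)
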